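/- For $\mathsf a,\mathsf c\in\mathbb R$ let $\eta^{(\mathsf a,\mathsf c)}=(\eta^{(\mathsf a,\mathsf c)}_t)_{t\in[0,1]}$ be a stochastic process with continuous paths whose law on $C([0,1])$ is given by $$\frac{d\mathbb P_{\eta^{(\mathsf a,\mathsf c)}}}{d\mathbb P_{\rm Bm}}(\omega)=\frac{e^{(\mathsf a+\mathsf c)\min_{t\in[0,1]}\omega_t-\mathsf a\omega_1}}{\mathbb E_{\rm Bm}\big[e^{(\mathsf a+\mathsf c)\min_{t\in[0,1]}\omega_t-\mathsf a\omega_1}\big]},\qquad \omega\in C([0,1]),$$ where $\mathbb P_{\rm Bm}$ is the law on $C([0,1])$ of a standard Brownian motion and $\mathbb E_{\rm Bm}$ the corresponding expectation. Let $$\mathcal H(\mathsf a,\mathsf c)=\begin{cases}\dfrac{\mathsf a H(\mathsf a/\sqrt2)-\mathsf c H(\mathsf c/\sqrt2)}{\mathsf a-\mathsf c},&\mathsf a\ne\mathsf c,\\[2mm](1+\mathsf a^2)H(\mathsf a/\sqrt2)-\sqrt{2/\pi}\,\mathsf a,&\mathsf a=\mathsf c,\end{cases}\qquad H(x)=e^{x^2}\frac{2}{\sqrt\pi}\int_x^\infty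 e^{-s^2}\,ds,$$ and for $t>0$ and $b,x,y\in\mathbb R$ let $$\mathsf q^{(b)}_t(x,y)=\frac1{\sqrt{2\pi t}}\Big[e^{-(x-y)^2/(2t)}-e^{-(x+y-2b)^2/(2t)}\Big]\mathbf 1_{\{x,y>b\}}$$ be the transition kernel of Brownian motion killed at hitting level $b$. Proposition. Let $0=t_0<t_1<\cdots<t_d=1$ and $\Delta t_k=t_k-t_{k-1}$. Then $(\eta^{(\mathsf a,\mathsf c)}_{t_1},\dots,\eta^{(\mathsf a,\mathsf c)}_{t_d})$ has the joint probability density function, with respect to Lebesgue measure on $\mathbb R^d$, $$p^{(\mathsf a,\mathsf c)}_{t_1,\dots,t_d}(z_1,\dots,z_d)=\frac1{\mathcal H(\mathsf a,\mathsf c)}\int_{-\infty}^{\min_{k=0,\dots,d}z_k}e^{(\mathsf a+\mathsf c)b-\mathsf a z_d}\,(-\partial_b)\Big(\prod_{k=1}^d\mathsf q^{(b)}_{\Delta t_k}(z_{k-1},z_k)\Big)\,db,\qquad (z_1,\dots,z_d)\in\mathbb R^d,$$ with $z_0=0$. Here, for every $(z_1,\dots,z_d)\in\mathbb R^d$, the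 product is differentiable in $b$ for $b<\min_{k}z_k$ and the integral converges absolutely; $p^{(\mathsf a,\mathsf c)}_{t_1,\dots,t_d}$ is measurable and nonnegative. -/

import Mathlib

open MeasureTheory ProbabilityTheory
open scoped unitInterval NNReal

noncomputable section

namespace OpenKPZ

/-! ### The path space `C([0,1])` and the law of Brownian motion on it -/

/-- The space `C([0,1])` of continuous paths, with the topology of uniform convergence, carries its
Borel σ-algebra. -/
instance pathMeasurableSpace : MeasurableSpace C(I, ℝ) := borel _

instance pathBorelSpace : BorelSpace C(I, ℝ) := ⟨rfl⟩

/-- The path on `[0,1]` of a real process `B = (B_t)_{t ≥ 0}` at the sample point `x`.  It is the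
actual restriction of `t ↦ B_t(x)` to `[0,1]` whenever that restriction is continuous, which is
almost surely the case for a Brownian motion; on the remaining null set it is the zero path. -/
def pathOn {Ω : Type*} (B : ℝ≥0 → Ω → ℝ) (x : Ω) : C(I, ℝ) :=
  open Classical in
  if h : Continuous (fun s : I => B ⟨s, s.2.1⟩ x) then ⟨fun s : I => B ⟨s, s.2.1⟩ x, h⟩ else 0

/-- The law on `C([0,1])` of the process `B` under `P`. -/
def pathLaw {Ω : Type*} [MeasurableSpace Ω] (P : Measure Ω) (B : ℝ≥0 → Ω → ℝ) :
    Measure C(I, ℝ) :=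
  P.map (pathOn B)

/-- A map into `C([0,1])` is Borel measurable as soon as its evaluations are measurable. -/
theorem measurable_path_of_eval {Ω : Type*} [MeasurableSpace Ω] {F : Ω → C(I, ℝ)}
    (hF : ∀ s : I, Measurable fun x => F x s) : Measurable F := by
  have hball : ∀ (g : C(I, ℝ)) (r : ℝ), 0 ≤ r →
      MeasurableSet (F ⁻¹' Metric.closedBall g r) := by
    intro g r hr
    have key : F ⁻¹' Metric.closedBall g r =
        ⋂ n : ℕ, {x | dist (F x (TopologicalSpace.denseSeq I n))
          (g (TopologicalSpace.denseSeq I n)) ≤ r} := by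
      ext x
      simp only [Set.mem_preimage, Metric.mem_closedBall, Set.mem_iInter, Set.mem_ofPred_eq]
      constructor
      · exact fun h n => (ContinuousMap.dist_apply_le_dist _).trans h
      · intro h
        rw [ContinuousMap.dist_le hr]
        have hcl : IsClosed {s : I | dist (F x s) (g s) ≤ r} :=
          isClosed_le (by fun_prop) continuous_const
        have hd := (TopologicalSpace.denseRange_denseSeq I).closure_eq
        intro s
        have hs : s ∈ closure (Set.range (TopologicalSpace.denseSeq I)) := by
          rw [hd]; trivial
        refine closure_minimal ?_ hcl hs
        rintro _ ⟨n, rfl⟩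
        exact h n
    rw [key]
    refine MeasurableSet.iInter fun n => ?_
    exact measurableSet_le ((hF _).dist measurable_const) measurable_const
  refine measurable_of_isOpen fun U hU => ?_
  have hr : ∀ g : C(I, ℝ), ∃ r : ℝ, 0 < r ∧ (g ∈ U → Metric.closedBall g r ⊆ U) := by
    intro g
    by_cases hg : g ∈ U
    · obtain ⟨r, hr, h⟩ := Metric.nhds_basis_closedBall.mem_iff.1 (hU.mem_nhds hg)
      exact ⟨r, hr, fun _ => h⟩
    · exact ⟨1, one_pos, fun h => absurd h hg⟩
  choose r hr0 hrU using hr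
  obtain ⟨S, hSU, hSc, hcov⟩ := TopologicalSpace.countable_cover_nhdsWithin
    (f := fun g => Metric.closedBall g (r g)) (s := U)
    (fun g _ => mem_nhdsWithin_of_mem_nhds (Metric.closedBall_mem_nhds g (hr0 g)))
  have hUeq : U = ⋃ g ∈ S, Metric.closedBall g (r g) :=
    hcov.antisymm (Set.iUnion₂_subset fun g hg => hrU g (hSU hg))
  rw [hUeq, Set.preimage_iUnion₂]
  exact MeasurableSet.biUnion hSc fun g _ => hball g _ (hr0 g).le

/-- The path map of a Brownian motion is almost everywhere measurable, so that `pathLaw P B` is a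
genuine image measure. -/
theorem aemeasurable_pathOn {Ω : Type*} [MeasurableSpace Ω] {P : Measure Ω} {B : ℝ≥0 → Ω → ℝ}
    (hB : IsBrownianReal B P) : AEMeasurable (pathOn B) P := by
  have hmk : ∀ᵐ x ∂P, ∀ n : ℕ,
      B ⟨TopologicalSpace.denseSeq I n, (TopologicalSpace.denseSeq I n).2.1⟩ x =
        (hB.aemeasurable ⟨TopologicalSpace.denseSeq I n,
          (TopologicalSpace.denseSeq I n).2.1⟩).mk _ x :=
    ae_all_iff.2 fun n => (hB.aemeasurable _).ae_eq_mk
  have hall := hmk.and hB.cont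
  obtain ⟨N, hNsub, hNm, hN0⟩ := exists_measurable_superset_of_null (ae_iff.1 hall)
  have hgood : ∀ x, x ∉ N → (∀ n : ℕ,
      B ⟨TopologicalSpace.denseSeq I n, (TopologicalSpace.denseSeq I n).2.1⟩ x =
        (hB.aemeasurable ⟨TopologicalSpace.denseSeq I n,
          (TopologicalSpace.denseSeq I n).2.1⟩).mk _ x) ∧ Continuous fun t => B t x := by
    intro x hx
    by_contra h
    exact hx (hNsub h)
  classical
  let G : Ω → C(I, ℝ) := fun x => if x ∈ N then 0 else pathOn B x
  have hdense : ∀ n : ℕ, Measurable fun x => G x (TopologicalSpace.denseSeq I n) := by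
    intro n
    have : (fun x => G x (TopologicalSpace.denseSeq I n)) = fun x => if x ∈ N then 0 else
        (hB.aemeasurable ⟨TopologicalSpace.denseSeq I n,
          (TopologicalSpace.denseSeq I n).2.1⟩).mk _ x := by
      funext x
      by_cases hx : x ∈ N
      · simp [G, hx]
      · have hc : Continuous (fun s : I => B ⟨s, s.2.1⟩ x) :=
          (hgood x hx).2.comp (by fun_prop)
        simp only [G, hx, if_false, pathOn, dif_pos hc]
        exact (hgood x hx).1 n
    rw [this]
    exact Measurable.ite hNm measurable_const (hB.aemeasurable _).measurable_mk
  refine ⟨G, measurable_path_of_eval fun s => ?_, ?_⟩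
  · have hs : s ∈ closure (Set.range (TopologicalSpace.denseSeq I)) := by
      rw [(TopologicalSpace.denseRange_denseSeq I).closure_eq]; trivial
    obtain ⟨u, hu, hlim⟩ := mem_closure_iff_seq_limit.1 hs
    choose k hk using hu
    refine measurable_of_tendsto_metrizable (f := fun m x => G x (u m)) (fun m => ?_) ?_
    · rw [← hk m]; exact hdense (k m)
    · exact tendsto_pi_nhds.2 fun x => ((G x).continuous.tendsto s).comp hlim
  · have : ∀ᵐ x ∂P, x ∉ N := by rw [ae_iff]; simpa using hN0
    filter_upwards [this] with x hx
    simp [G, hx]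

/-! ### The process `η` -/

/-- The unnormalised weight `exp((a + c) min_{[0,1]} ω - a ω_1)` of a path `ω`.  The infimum over the
compact interval is attained. -/
def pathWeight (a c : ℝ) (ω : C(I, ℝ)) : ℝ :=
  Real.exp ((a + c) * (⨅ s : I, ω s) - a * ω 1)

/-- The law of `η^{(a,c)}`: given the law `W` on `C([0,1])` of a standard Brownian motion, it is the
measure with Radon-Nikodym derivative `pathWeight / E_W[pathWeight]` with respect to `W`. -/
def etaLaw (a c : ℝ) (W : Measure C(I, ℝ)) : Measure C(I, ℝ) :=
  W.withDensity fun ω => ENNReal.ofReal (pathWeight a c ω / ∫ ω', pathWeight a c ω' ∂W)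

/-! ### The normalising constant -/

/-- The complementary error function. -/
def erfc (x : ℝ) : ℝ :=
  2 / Real.sqrt Real.pi * ∫ s in Set.Ioi x, Real.exp (-s ^ 2)

/-- `H(x) = exp(x²) erfc(x)`. -/
def expErfc (x : ℝ) : ℝ := Real.exp (x ^ 2) * erfc x

/-- The explicit constant `𝓗(a,c)`. -/
def calH (a c : ℝ) : ℝ :=
  if a = c then
    (1 + a ^ 2) * expErfc (a / Real.sqrt 2) - Real.sqrt (2 / Real.pi) * a
  else
    (a * expErfc (a / Real.sqrt 2) - c * expErfc (c / Real.sqrt 2)) / (a - c)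

/-! ### Killed Brownian motion and the joint density -/

/-- The transition kernel `q_t(x,y)` of Brownian motion killed at hitting zero. -/
def killedKernel (t x y : ℝ) : ℝ :=
  if 0 < x ∧ 0 < y then
    1 / Real.sqrt (2 * Real.pi * t) *
      (Real.exp (-(1 / (2 * t)) * (x - y) ^ 2) - Real.exp (-(1 / (2 * t)) * (x + y) ^ 2))
  else 0

/-- The transition kernel `q_t^{(b)}(x,y)` of Brownian motion killed at hitting the level `b`. -/
def killedKernelAt (b t x y : ℝ) : ℝ := killedKernel t (x - b) (y - b)

/-- `∏_{k=1}^d q^{(b)}_{t_k - t_{k-1}}(z_{k-1}, z_k)`, for times `t_0, …, t_d` and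
values `z_0, …, z_d`. -/
def killedProduct {d : ℕ} (t z : Fin (d + 1) → ℝ) (b : ℝ) : ℝ :=
  ∏ k : Fin d, killedKernelAt b (t k.succ - t k.castSucc) (z k.castSucc) (z k.succ)

/-- `min_{k=0,…,d} z_k`. -/
def minValue {d : ℕ} (z : Fin (d + 1) → ℝ) : ℝ :=
  Finset.univ.inf' Finset.univ_nonempty z

/-- The integrand
`exp((a + c) b - a z_d) (-∂_b) ∏_{k=1}^d q^{(b)}_{t_k - t_{k-1}}(z_{k-1}, z_k)`. -/
def densityIntegrand {d : ℕ} (a c : ℝ) (t z : Fin (d + 1) → ℝ) (b : ℝ) : ℝ :=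
  Real.exp ((a + c) * b - a * z (Fin.last d)) * (-deriv (killedProduct t z) b)

/-- The joint density `p^{(a,c)}_{t_1,…,t_d}(z_1,…,z_d)`; the arguments are `t = (t_0,…,t_d)` and
`z = (z_1,…,z_d)`, and `Fin.cons 0 z` is `(z_0,z_1,…,z_d)` with `z_0 = 0`. -/
def jointDensity {d : ℕ} (a c : ℝ) (t : Fin (d + 1) → ℝ) (z : Fin d → ℝ) : ℝ :=
  1 / calH a c * ∫ b in Set.Iic (minValue (Fin.cons 0 z)), densityIntegrand a c t (Fin.cons 0 z) b

end OpenKPZ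

end

namespace OpenKPZ

open Filter Topology

/-! The weight defining `etaLaw` depends on a path only through its minimum `m` and its final value.
It is therefore enough to know the joint law, under Brownian motion, of `m` and of the values at
`t_1, …, t_d`, and then to integrate out `m`.

For `b ≤ 0`, the values at these times on the event that the path stays above `b` have density
`killedProduct` at level `b`. For one time this is the reflection principle
(`map_restrict_eq_map_reflect`, `map_restrict_le_pathMin`). For several times it follows by
induction, from independence of the increments after `t_{d-1}` (`map_restrict_le_pathMin_pi`). The
product vanishes once `b` reaches the least of the `z_k`, so it is the integral of its own `-∂_b`
over levels above `b`. Hence `-∂_b` of the product is the joint density of minimum and values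
(`map_pathMin_prod`).

The reflection principle is proved without a strong Markov property. On a mesh of `[0,T]` the first
index below `b` is determined by the past, so the later increment may be flipped in sign at that
index. As the mesh is refined, the overshoot below `b` tends to zero by continuity, and flipping
becomes reflection at `b`.

The constant comes from the case `d = 1`. With `s = y - 2m` the density of minimum and endpoint
depends on `s` alone, on the region `-s < m < 0`. Integrating the weight over `m` leaves Gaussian
half-line integrals, which evaluate to `calH` (`lintegral_weight`). The pieces are assembled on path
space in `map_etaLaw`. -/

/-! ### Regular versions of Brownian motion -/

/-- A Brownian motion with measurable marginals whose paths are all continuous and start at `0`. -/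
structure IsRegularBrownian {Ω : Type*} [MeasurableSpace Ω] (X : ℝ≥0 → Ω → ℝ) (P : Measure Ω) :
    Prop extends IsBrownianReal X P where
  meas : ∀ t, Measurable (X t)
  continuous_path : ∀ ω, Continuous fun t => X t ω
  zero : ∀ ω, X 0 ω = 0

section Regular

variable {Ω : Type*} [MeasurableSpace Ω] {P : Measure Ω}

/-- Every Brownian motion has an indistinguishable regular version. -/
theorem exists_isRegularBrownian {B : ℝ≥0 → Ω → ℝ} (hB : IsBrownianReal B P) :
    ∃ X : ℝ≥0 → Ω → ℝ, IsRegularBrownian X P ∧ ∀ᵐ ω ∂P, ∀ t, B t ω = X t ω := by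
  have hmk : ∀ᵐ x ∂P, ∀ n : ℕ, B (TopologicalSpace.denseSeq ℝ≥0 n) x =
        (hB.aemeasurable (TopologicalSpace.denseSeq ℝ≥0 n)).mk _ x :=
    ae_all_iff.2 fun n => (hB.aemeasurable _).ae_eq_mk
  have hall := (hmk.and hB.cont).and hB.eval_zero_ae_eq_zero
  obtain ⟨N, hNsub, hNm, hN0⟩ := exists_measurable_superset_of_null (ae_iff.1 hall)
  have hgood : ∀ x, x ∉ N → ((∀ n : ℕ, B (TopologicalSpace.denseSeq ℝ≥0 n) x =
        (hB.aemeasurable (TopologicalSpace.denseSeq ℝ≥0 n)).mk _ x) ∧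
        Continuous fun t => B t x) ∧ B 0 x = 0 := by
    intro x hx
    by_contra h
    exact hx (hNsub h)
  classical
  let X : ℝ≥0 → Ω → ℝ := fun t x => if x ∈ N then 0 else B t x
  have hcont : ∀ x, Continuous fun t => X t x := by
    intro x
    by_cases hx : x ∈ N
    · simpa [X, hx] using continuous_const
    · simpa [X, hx] using (hgood x hx).1.2
  have hae : ∀ᵐ ω ∂P, ∀ t, B t ω = X t ω := by
    have : ∀ᵐ x ∂P, x ∉ N := by rw [ae_iff]; simpa using hN0
    filter_upwards [this] with x hx t
    simp [X, hx]
  have hdense : ∀ n : ℕ, Measurable (X (TopologicalSpace.denseSeq ℝ≥0 n)) := by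
    intro n
    have : X (TopologicalSpace.denseSeq ℝ≥0 n) = fun x => if x ∈ N then 0 else
        (hB.aemeasurable (TopologicalSpace.denseSeq ℝ≥0 n)).mk _ x := by
      funext x
      by_cases hx : x ∈ N
      · simp [X, hx]
      · simpa [X, hx] using (hgood x hx).1.1 n
    rw [this]
    exact Measurable.ite hNm measurable_const (hB.aemeasurable _).measurable_mk
  refine ⟨X, ⟨⟨hB.toIsPreBrownianReal.congr fun t => ?_, ?_⟩, fun t => ?_, hcont, fun x => ?_⟩, hae⟩
  · filter_upwards [hae] with x hx using hx t
  · exact Eventually.of_forall hcont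
  · have hs : t ∈ closure (Set.range (TopologicalSpace.denseSeq ℝ≥0)) := by
      rw [(TopologicalSpace.denseRange_denseSeq ℝ≥0).closure_eq]; trivial
    obtain ⟨u, hu, hlim⟩ := mem_closure_iff_seq_limit.1 hs
    choose k hk using hu
    refine measurable_of_tendsto_metrizable (f := fun m => X (u m)) (fun m => ?_) ?_
    · rw [← hk m]; exact hdense (k m)
    · exact tendsto_pi_nhds.2 fun x => ((hcont x).tendsto t).comp hlim
  · by_cases hx : x ∈ N
    · simp [X, hx]
    · simpa [X, hx] using (hgood x hx).2

theorem IsRegularBrownian.shift {X : ℝ≥0 → Ω → ℝ} (hX : IsRegularBrownian X P) (t₀ : ℝ≥0) :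
    IsRegularBrownian (fun t ω => X (t₀ + t) ω - X t₀ ω) P where
  toIsBrownianReal := hX.toIsBrownianReal.shift t₀
  meas t := (hX.meas _).sub (hX.meas _)
  continuous_path ω := by
    have := hX.continuous_path ω
    fun_prop
  zero ω := by simp

/-! ### Running minima -/

/-- The minimum of a path over `[0, T]`. -/
noncomputable def pathMin (T : ℝ≥0) (w : ℝ≥0 → ℝ) : ℝ := ⨅ s : I, w (T * ⟨s, s.2.1⟩)

theorem continuous_rescale {w : ℝ≥0 → ℝ} (hw : Continuous w) (T : ℝ≥0) :
    Continuous fun s : I => w (T * ⟨s, s.2.1⟩) := by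
  fun_prop

theorem bddBelow_range_of_continuous {f : I → ℝ} (hf : Continuous f) :
    BddBelow (Set.range f) :=
  (isCompact_range hf).bddBelow

theorem le_pathMin_iff {w : ℝ≥0 → ℝ} (hw : Continuous w) {T : ℝ≥0} {b : ℝ} :
    b ≤ pathMin T w ↔ ∀ s ≤ T, b ≤ w s := by
  unfold pathMin
  rw [le_ciInf_iff (bddBelow_range_of_continuous (continuous_rescale hw T))]
  constructor
  · intro h s hs
    rcases eq_or_ne T 0 with rfl | hT
    · have : b ≤ w (0 * (0 : ℝ≥0)) := h 0
      have hs0 : s = 0 := by simpa using hs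
      rwa [zero_mul, ← hs0] at this
    · have hT' : 0 < T := pos_of_ne_zero hT
      have h1 : s / T ≤ 1 := div_le_one_of_le₀ hs hT'.le
      have := h ⟨(s / T : ℝ≥0), (s / T).2, by exact_mod_cast h1⟩
      have e : T * (s / T) = s := mul_div_cancel₀ s hT
      rw [← e]
      exact this
  · intro h s
    refine h _ ?_
    have : (⟨s, s.2.1⟩ : ℝ≥0) ≤ 1 := by exact_mod_cast s.2.2
    exact mul_le_of_le_one_right' this

/-- The infimum of a continuous function over `[0,1]` is an infimum over a dense sequence. -/
theorem iInf_eq_iInf_denseSeq {f : I → ℝ} (hf : Continuous f) :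
    ⨅ s, f s = ⨅ n, f (TopologicalSpace.denseSeq I n) := by
  have hb := bddBelow_range_of_continuous hf
  refine le_antisymm (le_ciInf fun n => ciInf_le hb _) (le_ciInf fun s => ?_)
  have hcl : IsClosed {s : I | ⨅ n, f (TopologicalSpace.denseSeq I n) ≤ f s} :=
    isClosed_le continuous_const hf
  have hs : s ∈ closure (Set.range (TopologicalSpace.denseSeq I)) := by
    rw [(TopologicalSpace.denseRange_denseSeq I).closure_eq]; trivial
  refine closure_minimal ?_ hcl hs
  rintro _ ⟨n, rfl⟩
  refine ciInf_le (hb.mono ?_) n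
  rintro _ ⟨n, rfl⟩
  exact ⟨_, rfl⟩

/-- A version of `pathMin` which is measurable for the product σ-algebra. -/
noncomputable def densePathMin (T : ℝ≥0) (w : ℝ≥0 → ℝ) : ℝ :=
  ⨅ n, w (T * ⟨TopologicalSpace.denseSeq I n, (TopologicalSpace.denseSeq I n).2.1⟩)

theorem measurable_densePathMin (T : ℝ≥0) : Measurable (densePathMin T) :=
  Measurable.iInf fun _ => measurable_pi_apply _

theorem pathMin_eq_densePathMin {w : ℝ≥0 → ℝ} (hw : Continuous w) (T : ℝ≥0) :
    pathMin T w = densePathMin T w :=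
  iInf_eq_iInf_denseSeq (continuous_rescale hw T)

theorem IsRegularBrownian.measurable_pathMin {X : ℝ≥0 → Ω → ℝ} (hX : IsRegularBrownian X P)
    (T : ℝ≥0) : Measurable fun ω => pathMin T fun t => X t ω := by
  simp_rw [pathMin_eq_densePathMin (hX.continuous_path _)]
  exact (measurable_densePathMin T).comp (measurable_pi_lambda _ hX.meas)

/-! ### The reflection principle -/

/-- `w` first falls below `b`, among the times `T j / N`, at the index `j`. -/
def FirstBelow (T : ℝ≥0) (N : ℕ) (b : ℝ) (w : ℝ≥0 → ℝ) (j : ℕ) : Prop :=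
  w (T * j / N) < b ∧ ∀ i < j, b ≤ w (T * i / N)

theorem FirstBelow.unique {T : ℝ≥0} {N : ℕ} {b : ℝ} {w : ℝ≥0 → ℝ} {i j : ℕ}
    (hi : FirstBelow T N b w i) (hj : FirstBelow T N b w j) : i = j := by
  rcases lt_trichotomy i j with h | h | h
  · exact absurd hi.1 (not_lt.2 (hj.2 i h))
  · exact h
  · exact absurd hj.1 (not_lt.2 (hi.2 j h))

theorem mul_div_le_self {T : ℝ≥0} {N j : ℕ} (hj : j ≤ N) : T * j / N ≤ T := by
  rcases Nat.eq_zero_or_pos N with rfl | hN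
  · simp
  · rw [div_le_iff₀ (by exact_mod_cast hN)]
    gcongr

/-- If a continuous path falls below `b` on `[0,T]`, then so does its restriction to a fine mesh,
and the first value below `b` on the mesh is close to `b`. -/
theorem eventually_exists_firstBelow {w : ℝ≥0 → ℝ} (hw : Continuous w) {b : ℝ} (h0 : b ≤ w 0)
    {T s : ℝ≥0} (hs : s ≤ T) (hsb : w s < b) {ε : ℝ} (hε : 0 < ε) :
    ∀ᶠ N : ℕ in atTop, ∃ j ≤ N, FirstBelow T N b w j ∧ |w (T * j / N) - b| < ε := by
  have huc := (isCompact_Icc (a := (0 : ℝ≥0)) (b := T)).uniformContinuousOn_of_continuous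
    hw.continuousOn
  rw [Metric.uniformContinuousOn_iff] at huc
  -- The bound `b - w s` keeps a mesh point near `s` below `b`; the bound `ε` controls the drop over
  -- one mesh step.
  obtain ⟨δ, hδ, hδw⟩ := huc (min ε (b - w s)) (lt_min hε (by linarith))
  have hlim : Tendsto (fun N : ℕ => (T : ℝ) / N) atTop (𝓝 0) :=
    tendsto_const_div_atTop_nhds_zero_nat _
  filter_upwards [hlim.eventually (gt_mem_nhds hδ), eventually_gt_atTop 0] with N hN hN0
  have hNR : (0 : ℝ) < N := by exact_mod_cast hN0
  have hT : 0 < T := by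
    rcases eq_or_ne T 0 with rfl | hT
    · have : s = 0 := by simpa using hs
      subst this; linarith
    · exact pos_of_ne_zero hT
  have hTR : (0 : ℝ) < T := hT
  have hmesh : ∃ j, j ≤ N ∧ w (T * j / N) < b := by
    have hle : (s : ℝ) ≤ T := hs
    -- The last mesh point not after `s`; it is within `T / N` of `s`.
    set j := ⌊(N : ℝ) * s / T⌋₊
    have hj1 : (j : ℝ) ≤ N * s / T := Nat.floor_le (by positivity)
    have hj2 : (N : ℝ) * s / T < j + 1 := Nat.lt_floor_add_one _
    have hjN : j ≤ N := by
      have : (j : ℝ) ≤ N := hj1.trans (by rw [div_le_iff₀ hTR]; gcongr)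
      exact_mod_cast this
    refine ⟨j, hjN, ?_⟩
    have hd : dist (T * j / N) s < δ := by
      refine lt_of_le_of_lt ?_ hN
      rw [NNReal.dist_eq]
      push_cast
      rw [le_div_iff₀ hTR] at hj1
      rw [div_lt_iff₀ hTR] at hj2
      rw [abs_le]
      constructor
      · rw [← sub_nonneg]
        have : (T : ℝ) * j / N - s - -(T / N) = ((j + 1) * T - N * s) / N := by
          field_simp; ring
        rw [this]
        exact div_nonneg (by linarith) hNR.le
      · rw [← sub_nonneg]
        have : (T : ℝ) / N - (T * j / N - s) = (T + (N * s - j * T)) / N := by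
          field_simp; ring
        rw [this]
        exact div_nonneg (by linarith) hNR.le
    have := hδw _ ⟨zero_le, mul_div_le_self hjN⟩ s ⟨zero_le, hs⟩ hd
    have h2 := (abs_lt.1 (this.trans_le (min_le_right _ _))).2
    linarith
  classical
  have hex : ∃ j : ℕ, w (T * j / N) < b := hmesh.imp fun _ h => h.2
  have hfirst : FirstBelow T N b w (Nat.find hex) :=
    ⟨Nat.find_spec hex, fun i hi => not_lt.1 (Nat.find_min hex hi)⟩
  obtain ⟨j, hjN, hj⟩ := hmesh
  have hle : Nat.find hex ≤ N := (Nat.find_min' hex hj).trans hjN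
  refine ⟨Nat.find hex, hle, hfirst, ?_⟩
  set m := Nat.find hex
  -- Since `b ≤ w 0`, the first index below `b` has a predecessor. The value there is at least `b`,
  -- so the overshoot is at most the drop over one step.
  have hm0 : m ≠ 0 := by
    intro h
    have := hfirst.1
    rw [h] at this
    simp at this
    linarith
  obtain ⟨k, hk⟩ := Nat.exists_eq_succ_of_ne_zero hm0
  have hkb : b ≤ w (T * k / N) := hfirst.2 k (by omega)
  have hd : dist (T * m / N) (T * k / N) < δ := by
    refine lt_of_le_of_lt (le_of_eq ?_) hN
    rw [NNReal.dist_eq, hk]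
    push_cast
    have : (T : ℝ) * (k + 1) / N - T * k / N = T / N := by ring
    rw [this, abs_of_pos (by positivity)]
  have h1 := hδw _ ⟨zero_le, mul_div_le_self hle⟩ _
    ⟨zero_le, mul_div_le_self (by omega : k ≤ N)⟩ hd
  have h2 := (abs_lt.1 (h1.trans_le (min_le_left _ _))).1
  have h3 := hfirst.1
  rw [abs_lt]
  constructor <;> linarith

open Classical in
-- At most one index is the first below `b`, so the sum has at most one nonzero term. Its argument
-- tends to `b` because the overshoot vanishes; if the path never goes below `b`, every term is
-- zero.
theorem tendsto_sum_firstBelow {w : ℝ≥0 → ℝ} (hw : Continuous w) {b : ℝ} (h0 : b ≤ w 0)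
    (T : ℝ≥0) {φ : ℝ → ENNReal} (hφ : Continuous φ) :
    Tendsto (fun N : ℕ => ∑ j ∈ Finset.range (N + 1),
        if FirstBelow T N b w j then φ (w (T * j / N)) else 0) atTop
      (𝓝 (if pathMin T w < b then φ b else 0)) := by
  split_ifs with h
  · have h' : ∃ s ≤ T, w s < b := by
      by_contra hne
      push Not at hne
      exact absurd h (not_lt.2 ((le_pathMin_iff hw).2 hne))
    obtain ⟨s, hs, hsb⟩ := h'
    rw [tendsto_def]
    intro U hU
    obtain ⟨ε, hε, hεU⟩ := Metric.mem_nhds_iff.1 (hφ.tendsto b hU)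
    filter_upwards [eventually_exists_firstBelow hw h0 hs hsb hε] with N ⟨j, hj, hf, hd⟩
    rw [Set.mem_preimage, Finset.sum_eq_single j]
    · rw [if_pos hf]
      exact hεU (by rwa [Metric.mem_ball, Real.dist_eq])
    · intro i _ hij
      rw [if_neg fun hi => hij (hi.unique hf)]
    · intro hj'
      simp at hj'
      omega
  · have : ∀ N : ℕ, (∑ j ∈ Finset.range (N + 1),
        if FirstBelow T N b w j then φ (w (T * j / N)) else 0) = 0 := by
      intro N
      refine Finset.sum_eq_zero fun j hj => ?_
      rw [if_neg]
      intro hf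
      refine h (lt_of_le_of_lt ?_ hf.1)
      exact (le_pathMin_iff hw).1 le_rfl _
        (mul_div_le_self (by simpa [Nat.lt_succ_iff] using hj))
    simp only [this]
    exact tendsto_const_nhds

end Regular

section Reflection

variable {Ω : Type*} [MeasurableSpace Ω] {P : Measure Ω} {X : ℝ≥0 → Ω → ℝ}

theorem IsRegularBrownian.isProbabilityMeasure (hX : IsRegularBrownian X P) :
    IsProbabilityMeasure P :=
  hX.isGaussianProcess.isProbabilityMeasure

/-- The path up to time `t₀` is independent of the increments after `t₀`. -/
theorem IsRegularBrownian.indepFun_past_increment (hX : IsRegularBrownian X P) (t₀ : ℝ≥0) :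
    IndepFun (fun ω (t : Set.Iic t₀) => X t ω) (fun ω t => X (t₀ + t) ω - X t₀ ω) P :=
  (hX.toIsPreBrownianReal.indepFun_shift t₀).symm

/-- Reflecting the path after the time `t₀` preserves the joint law with the past. -/
theorem IsRegularBrownian.map_past_neg_increment (hX : IsRegularBrownian X P) {t₀ T : ℝ≥0}
    (h : t₀ ≤ T) :
    P.map (fun ω => ((fun t : Set.Iic t₀ => X t ω), X T ω - X t₀ ω)) =
      P.map (fun ω => ((fun t : Set.Iic t₀ => X t ω), -(X T ω - X t₀ ω))) := by
  have := hX.isProbabilityMeasure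
  have hmeas : Measurable fun ω (t : Set.Iic t₀) => X t ω :=
    measurable_pi_lambda _ fun t => hX.meas t
  have hY : Measurable fun ω => X T ω - X t₀ ω := (hX.meas _).sub (hX.meas _)
  have hind : IndepFun (fun ω (t : Set.Iic t₀) => X t ω) (fun ω => X T ω - X t₀ ω) P := by
    have h1 := (hX.indepFun_past_increment t₀).comp measurable_id
      (measurable_pi_apply (T - t₀))
    have e : t₀ + (T - t₀) = T := add_tsub_cancel_of_le h
    simpa only [Function.comp_def, id, e] using h1
  have hind' := hind.comp measurable_id measurable_neg
  -- The increment is a centred Gaussian, so its law is even.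
  have hneg : P.map (fun ω => -(X T ω - X t₀ ω)) = P.map (fun ω => X T ω - X t₀ ω) := by
    have h1 := (hX.toIsPreBrownianReal.hasLaw_sub T t₀)
    have h2 := gaussianReal_neg h1
    rw [neg_zero] at h2
    exact h2.map_eq.trans h1.map_eq.symm
  rw [(indepFun_iff_map_prod_eq_prod_map_map hmeas.aemeasurable hY.aemeasurable).1 hind]
  have h3 := (indepFun_iff_map_prod_eq_prod_map_map hmeas.aemeasurable
    hY.neg.aemeasurable).1 hind'
  exact (h3.trans (congrArg _ hneg)).symm

open Classical in
-- The event is decided by the path up to `T * j / N`, so flipping the sign of the later increment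
-- preserves the integral; the flip turns `X T` into `2 * X (T * j / N) - X T`.
theorem IsRegularBrownian.lintegral_firstBelow (hX : IsRegularBrownian X P) (T : ℝ≥0) {N j : ℕ}
    (hj : j ≤ N) (b : ℝ) {f : ℝ → ENNReal} (hf : Measurable f) :
    ∫⁻ ω, (if FirstBelow T N b (X · ω) j then f (X T ω) else 0) ∂P =
      ∫⁻ ω, (if FirstBelow T N b (X · ω) j then f (2 * X (T * j / N) ω - X T ω) else 0) ∂P := by
  set t₀ := T * j / N with ht₀
  have ht : t₀ ≤ T := mul_div_le_self hj
  have hmem : ∀ i : ℕ, i ≤ j → T * i / N ∈ Set.Iic t₀ := by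
    intro i hi
    simp only [Set.mem_Iic, ht₀]
    gcongr
  let S : Set ((Set.Iic t₀ → ℝ) × ℝ) := {p | p.1 ⟨t₀, Set.mem_Iic.2 le_rfl⟩ < b} ∩
    ⋂ i : Fin j, {p | b ≤ p.1 ⟨T * (i : ℕ) / N, hmem i i.2.le⟩}
  have hS : MeasurableSet S := by
    refine MeasurableSet.inter ?_ ?_
    · exact measurableSet_lt (by fun_prop) measurable_const
    · exact MeasurableSet.iInter fun i => measurableSet_le measurable_const (by fun_prop)
  have hSiff : ∀ ω y, ((fun t : Set.Iic t₀ => X t ω), y) ∈ S ↔ FirstBelow T N b (X · ω) j := by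
    intro ω y
    simp only [S, FirstBelow, Set.mem_ofPred_eq, Set.mem_inter_iff, Set.mem_iInter, ← ht₀]
    refine and_congr_right fun _ => ⟨fun h i hi => h ⟨i, hi⟩, fun h i => h i i.2⟩
  let g : (Set.Iic t₀ → ℝ) × ℝ → ENNReal := S.indicator fun p => f (p.1 ⟨t₀, Set.mem_Iic.2 le_rfl⟩ + p.2)
  have hg : Measurable g := Measurable.indicator (hf.comp (by fun_prop)) hS
  have hmeas : Measurable fun ω (t : Set.Iic t₀) => X t ω :=
    measurable_pi_lambda _ fun t => hX.meas t
  have hY : Measurable fun ω => X T ω - X t₀ ω := (hX.meas _).sub (hX.meas _)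
  have hYn : Measurable fun ω => -(X T ω - X t₀ ω) := hY.neg
  have key := congrArg (fun μ => ∫⁻ p, g p ∂μ) (hX.map_past_neg_increment ht)
  beta_reduce at key
  rw [lintegral_map hg (hmeas.prodMk hY), lintegral_map hg (hmeas.prodMk hYn)] at key
  convert key using 3 with ω ω
  · simp only [g, Set.indicator_apply, hSiff]
    congr 2
    ring
  · simp only [g, Set.indicator_apply, hSiff]
    congr 2
    ring

theorem measurableSet_firstBelow (hX : ∀ t, Measurable (X t)) (T : ℝ≥0) (N j : ℕ) (b : ℝ) :
    MeasurableSet {ω | FirstBelow T N b (X · ω) j} := by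
  have : {ω | FirstBelow T N b (X · ω) j} =
      {ω | X (T * j / N) ω < b} ∩ ⋂ i : Fin j, {ω | b ≤ X (T * (i : ℕ) / N) ω} := by
    ext ω
    simp only [FirstBelow, Set.mem_ofPred_eq, Set.mem_inter_iff, Set.mem_iInter]
    exact and_congr_right fun _ => ⟨fun h i => h i i.2, fun h i hi => h ⟨i, hi⟩⟩
  rw [this]
  exact (measurableSet_lt (hX _) measurable_const).inter
    (MeasurableSet.iInter fun i => measurableSet_le measurable_const (hX _))

open Classical in
-- Dominated convergence, with the constant `C` as dominating function because at most one summand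
-- is nonzero. The function `φ` may depend on `ω`, so that the value at time `T` can enter.
theorem IsRegularBrownian.tendsto_lintegral_firstBelow (hX : IsRegularBrownian X P) (T : ℝ≥0)
    {b : ℝ} (hb : b ≤ 0) {φ : Ω → ℝ → ENNReal} (hφ : ∀ ω, Continuous (φ ω))
    (hφm : Measurable (Function.uncurry φ)) {C : ℝ≥0} (hC : ∀ ω x, φ ω x ≤ C) :
    Tendsto (fun N : ℕ => ∑ j ∈ Finset.range (N + 1),
      ∫⁻ ω, (if FirstBelow T N b (X · ω) j then φ ω (X (T * j / N) ω) else 0) ∂P) atTop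
      (𝓝 (∫⁻ ω, (if pathMin T (X · ω) < b then φ ω b else 0) ∂P)) := by
  have := hX.isProbabilityMeasure
  have hm : ∀ N j : ℕ, Measurable fun ω =>
      if FirstBelow T N b (X · ω) j then φ ω (X (T * j / N) ω) else 0 := fun N j =>
    Measurable.ite (measurableSet_firstBelow hX.meas T N j b)
      (hφm.comp (measurable_id.prodMk (hX.meas _))) measurable_const
  simp_rw [← lintegral_finsetSum _ fun j _ => hm _ j]
  refine tendsto_lintegral_of_dominated_convergence (fun _ => C)
    (fun N => Finset.measurable_sum _ fun j _ => hm N j) (fun N => ?_) (by simp) ?_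
  · refine Eventually.of_forall fun ω => ?_
    by_cases h : ∃ j ∈ Finset.range (N + 1), FirstBelow T N b (X · ω) j
    · obtain ⟨j, hj, hfj⟩ := h
      simp only
      rw [Finset.sum_eq_single_of_mem j hj fun i _ hij => if_neg fun hi => hij (hi.unique hfj),
        if_pos hfj]
      exact hC _ _
    · push Not at h
      simp only
      rw [Finset.sum_eq_zero fun j hj => if_neg (h j hj)]
      exact zero_le
  · refine Eventually.of_forall fun ω => ?_
    exact tendsto_sum_firstBelow (hX.continuous_path ω) (by simpa [hX.zero] using hb) T (hφ ω)

/-- The reflection principle: on the event that Brownian motion falls below the level `b`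
before the time `T`, its value at time `T` and the reflection of this value at `b` have the same
law. -/
theorem IsRegularBrownian.map_restrict_eq_map_reflect (hX : IsRegularBrownian X P) (T : ℝ≥0)
    {b : ℝ} (hb : b ≤ 0) :
    (P.restrict {ω | pathMin T (X · ω) < b}).map (X T) =
      (P.restrict {ω | pathMin T (X · ω) < b}).map (fun ω => 2 * b - X T ω) := by
  classical
  have := hX.isProbabilityMeasure
  have hE : MeasurableSet {ω | pathMin T (X · ω) < b} :=
    measurableSet_lt (hX.measurable_pathMin T) measurable_const
  have hXT := hX.meas T
  refine ext_of_forall_lintegral_eq_of_IsFiniteMeasure fun f => ?_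
  have hfm : Measurable fun x => (f x : ENNReal) :=
    (ENNReal.continuous_coe.comp f.continuous).measurable
  rw [lintegral_map hfm hXT, lintegral_map hfm (by fun_prop),
    ← lintegral_indicator hE, ← lintegral_indicator hE]
  obtain ⟨C, hC⟩ : ∃ C : ℝ≥0, ∀ x, f x ≤ C := by
    obtain ⟨C, hC⟩ := f.isBounded_range.bddAbove
    exact ⟨C, fun x => hC ⟨x, rfl⟩⟩
  -- The two choices of `φ` give equal sums for every mesh by `lintegral_firstBelow`. Their limits
  -- are the two sides of the claim, the second with `x` replaced by `b`.
  have h1 := hX.tendsto_lintegral_firstBelow T hb (φ := fun ω _ => (f (X T ω) : ENNReal))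
    (fun ω => continuous_const) (hfm.comp (hXT.comp measurable_fst)) (C := C)
    (fun ω x => by exact_mod_cast hC _)
  have h2 := hX.tendsto_lintegral_firstBelow T hb
    (φ := fun ω x => (f (2 * x - X T ω) : ENNReal))
    (fun ω => ENNReal.continuous_coe.comp (f.continuous.comp (by fun_prop)))
    (hfm.comp ((measurable_snd.const_mul 2).sub (hXT.comp measurable_fst))) (C := C)
    (fun ω x => by exact_mod_cast hC _)
  have h3 := tendsto_nhds_unique h1 (h2.congr fun N => Finset.sum_congr rfl fun j hj =>
    (hX.lintegral_firstBelow T (by simpa [Nat.lt_succ_iff] using hj) b hfm).symm)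
  simpa only [Set.indicator_apply, Set.mem_ofPred_eq] using h3

/-- Method of images: the kernel is the Gaussian density at `y` minus the one at the mirror image `2
* b - y`, which is farther from `0`. The additive form avoids truncated subtraction. -/
theorem ofReal_killedKernelAt_add_gaussianPDF {T : ℝ≥0} (hT : T ≠ 0) {b y : ℝ} (hb : b < 0)
    (hy : b < y) :
    ENNReal.ofReal (killedKernelAt b T 0 y) + gaussianPDF 0 T (2 * b - y) = gaussianPDF 0 T y := by
  have hTR : (0 : ℝ) < T := by exact_mod_cast pos_of_ne_zero hT
  have h : killedKernelAt b T 0 y =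
      gaussianPDFReal 0 T y - gaussianPDFReal 0 T (2 * b - y) := by
    unfold killedKernelAt killedKernel gaussianPDFReal
    rw [if_pos ⟨by linarith, by linarith⟩, mul_sub, one_div]
    congr 3 <;> · ring_nf
  have hle : gaussianPDFReal 0 T (2 * b - y) ≤ gaussianPDFReal 0 T y := by
    unfold gaussianPDFReal
    gcongr _ * Real.exp (?_ / _)
    nlinarith [mul_pos (sub_pos.2 hy) (neg_pos.2 hb)]
  unfold gaussianPDF
  rw [← ENNReal.ofReal_add _ (gaussianPDFReal_nonneg _ _ _), h, sub_add_cancel]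
  rw [h]; linarith

theorem killedKernelAt_eq_zero_of_le {b t x y : ℝ} (h : x ≤ b ∨ y ≤ b) :
    killedKernelAt b t x y = 0 := by
  unfold killedKernelAt killedKernel
  rw [if_neg]
  rintro ⟨h1, h2⟩
  rcases h with h | h <;> linarith

theorem measurable_killedKernelAt (t : ℝ) :
    Measurable fun p : ℝ × ℝ × ℝ => killedKernelAt p.1 t p.2.1 p.2.2 := by
  unfold killedKernelAt killedKernel
  refine Measurable.ite (MeasurableSet.inter (s₁ := {p : ℝ × ℝ × ℝ | 0 < p.2.1 - p.1})
    (s₂ := {p : ℝ × ℝ × ℝ | 0 < p.2.2 - p.1}) ?_ ?_) (by fun_prop) measurable_const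
  · exact measurableSet_lt measurable_const (by fun_prop)
  · exact measurableSet_lt measurable_const (by fun_prop)

theorem _root_.Measurable.killedKernelAt {α : Type*} [MeasurableSpace α] {b x y : α → ℝ}
    (hb : Measurable b) (t : ℝ) (hx : Measurable x) (hy : Measurable y) :
    Measurable fun a => killedKernelAt (b a) t (x a) (y a) :=
  (measurable_killedKernelAt t).comp (f := fun a => (b a, x a, y a))
    (g := fun p : ℝ × ℝ × ℝ => OpenKPZ.killedKernelAt p.1 t p.2.1 p.2.2)
    (hb.prodMk (hx.prodMk hy))

/-- The law of a Brownian motion at time `T`, on the event that it stays above `b` until then. -/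
theorem IsRegularBrownian.map_restrict_le_pathMin (hX : IsRegularBrownian X P) {T : ℝ≥0}
    (hT : T ≠ 0) (b : ℝ) :
    (P.restrict {ω | b ≤ pathMin T (X · ω)}).map (X T) =
      volume.withDensity fun y => ENNReal.ofReal (killedKernelAt b T 0 y) := by
  classical
  have := hX.isProbabilityMeasure
  have hXT := hX.meas T
  have hle : ∀ s ≤ T, ∀ ω, pathMin T (X · ω) ≤ X s ω := fun s hs ω =>
    (le_pathMin_iff (hX.continuous_path ω)).1 le_rfl s hs
  have hEm : MeasurableSet {ω | b ≤ pathMin T (X · ω)} :=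
    measurableSet_le measurable_const (hX.measurable_pathMin T)
  have hlaw := (hX.hasLaw_eval T).map_eq
  rcases lt_or_ge 0 b with hb | hb
  · have : {ω | b ≤ pathMin T (X · ω)} = ∅ := by
      ext ω
      simpa using (hle 0 zero_le ω).trans_lt (by rwa [hX.zero])
    rw [this, Measure.restrict_empty, Measure.map_zero]
    simp [killedKernelAt_eq_zero_of_le (Or.inl hb.le)]
  ext A hA
  rw [withDensity_apply _ hA, Measure.map_apply hXT hA, Measure.restrict_apply (hXT hA)]
  -- The endpoint equals `b` with probability zero, so `A` can be cut down to `A ∩ (b, ∞)`, where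
  -- the image formula for the kernel applies.
  have hb0 : P {ω | X T ω = b} = 0 := by
    have : P {ω | X T ω = b} = P.map (X T) {b} := by
      rw [Measure.map_apply hXT (measurableSet_singleton b)]; rfl
    rw [this, hlaw]
    have := nullSingletonClass_gaussianReal (μ := 0) hT
    exact measure_singleton b
  set A' := A ∩ Set.Ioi b
  have hA' : MeasurableSet A' := hA.inter measurableSet_Ioi
  have hL : P (X T ⁻¹' A ∩ {ω | b ≤ pathMin T (X · ω)}) =
      P (X T ⁻¹' A' ∩ {ω | b ≤ pathMin T (X · ω)}) := by
    refine measure_congr ?_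
    have : ∀ᵐ ω ∂P, X T ω ≠ b := by rw [ae_iff]; simpa using hb0
    filter_upwards [this] with ω hω
    refine propext ⟨fun ⟨h1, h2⟩ => ⟨⟨h1, ?_⟩, h2⟩, fun ⟨h1, h2⟩ => ⟨h1.1, h2⟩⟩
    exact lt_of_le_of_ne (le_trans h2 (hle T le_rfl ω)) (Ne.symm hω)
  have hR : ∫⁻ y in A, ENNReal.ofReal (killedKernelAt b T 0 y) =
      ∫⁻ y in A', ENNReal.ofReal (killedKernelAt b T 0 y) := by
    rw [← lintegral_indicator hA, ← lintegral_indicator hA']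
    refine lintegral_congr fun y => ?_
    by_cases hy : b < y
    · simp [Set.indicator_apply, A', hy]
    · simp [Set.indicator_apply, killedKernelAt_eq_zero_of_le (Or.inr (not_lt.1 hy))]
  rw [hL, hR]
  have hrefl := congrArg (fun μ => μ A') (hX.map_restrict_eq_map_reflect T hb)
  have h2b : Measurable fun ω => 2 * b - X T ω := by fun_prop
  simp only [Measure.map_apply hXT hA', Measure.map_apply h2b hA',
    Measure.restrict_apply (hXT hA'), Measure.restrict_apply (h2b hA')] at hrefl
  -- If the reflected endpoint lies above `b`, the endpoint itself lies below `b`, so the condition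
  -- on the minimum is automatic.
  have hsub : (fun ω => 2 * b - X T ω) ⁻¹' A' ∩ {ω | pathMin T (X · ω) < b} =
      (fun ω => 2 * b - X T ω) ⁻¹' A' := by
    refine Set.inter_eq_left.2 fun ω hω => ?_
    have : b < 2 * b - X T ω := hω.2
    exact (hle T le_rfl ω).trans_lt (by linarith)
  rw [hsub] at hrefl
  have hsplit : P (X T ⁻¹' A' ∩ {ω | b ≤ pathMin T (X · ω)}) +
      P (X T ⁻¹' A' ∩ {ω | pathMin T (X · ω) < b}) = P (X T ⁻¹' A') := by
    have hc : {ω | pathMin T (X · ω) < b} = {ω | b ≤ pathMin T (X · ω)}ᶜ := by ext; simp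
    rw [hc, ← Set.sdiff_eq]
    exact measure_inter_add_sdiff _ hEm
  have hp1 : P (X T ⁻¹' A') = ∫⁻ y in A', gaussianPDF 0 T y := by
    rw [← Measure.map_apply hXT hA', hlaw, gaussianReal_apply _ hT]
  have hp2 : P ((fun ω => 2 * b - X T ω) ⁻¹' A') = ∫⁻ y in A', gaussianPDF 0 T (2 * b - y) := by
    have hm : Measurable fun x : ℝ => 2 * b - x := by fun_prop
    have e : (fun ω => 2 * b - X T ω) ⁻¹' A' = X T ⁻¹' ((fun x => 2 * b - x) ⁻¹' A') := rfl
    rw [e, ← Measure.map_apply hXT (hm hA'), hlaw, gaussianReal_apply _ hT,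
      ← lintegral_indicator (hm hA'), ← lintegral_indicator hA',
      ← lintegral_sub_left_eq_self _ (2 * b)]
    refine lintegral_congr fun y => ?_
    simp only [Set.indicator_apply, Set.mem_preimage, sub_sub_cancel]
  rw [hrefl, hp1, hp2] at hsplit
  -- At `b = 0` the two Gaussian terms coincide and the kernel is zero, so both sides vanish.
  rcases eq_or_lt_of_le hb with rfl | hb'
  · have hsym : ∀ y, gaussianPDF 0 T (2 * 0 - y) = gaussianPDF 0 T y := by
      intro y; simp [gaussianPDF, gaussianPDFReal]
    simp only [hsym] at hsplit
    have hfin : ∫⁻ y in A', gaussianPDF 0 T y ≠ ⊤ := by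
      rw [← hp1]; exact measure_ne_top _ _
    simp only [killedKernelAt_eq_zero_of_le (Or.inl le_rfl)]
    rw [ENNReal.ofReal_zero, lintegral_zero]
    exact (ENNReal.add_left_inj hfin).1 (by rw [hsplit, zero_add])
  · have hfin : ∫⁻ y in A', gaussianPDF 0 T (2 * b - y) ≠ ⊤ := by
      rw [← hp2]; exact measure_ne_top _ _
    refine (ENNReal.add_left_inj hfin).1 ?_
    rw [hsplit, ← lintegral_add_right _ (by fun_prop)]
    refine setLIntegral_congr_fun hA' fun y hy => ?_
    exact (ofReal_killedKernelAt_add_gaussianPDF hT hb' hy.2).symm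

end Reflection

/-! ### The Markov property for Brownian motion above a level -/

section Markov

theorem killedKernelAt_nonneg {t : ℝ} (ht : 0 ≤ t) (b x y : ℝ) : 0 ≤ killedKernelAt b t x y := by
  unfold killedKernelAt killedKernel
  split_ifs with h
  · refine mul_nonneg (by positivity) (sub_nonneg.2 (Real.exp_le_exp.2 ?_))
    refine mul_le_mul_of_nonpos_left ?_ (by simpa using ht)
    nlinarith [mul_pos h.1 h.2]
  · exact le_rfl

/-- Translation invariance: it restarts the killed motion at position `x`. -/
theorem killedKernelAt_sub_left (b t x y : ℝ) :
    killedKernelAt (b - x) t 0 y = killedKernelAt b t x (x + y) := by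
  unfold killedKernelAt
  congr 1 <;> ring

theorem measurable_cons_zero (d : ℕ) :
    Measurable fun z : Fin d → ℝ => (Fin.cons 0 z : Fin (d + 1) → ℝ) := by
  refine measurable_pi_iff.2 fun i => ?_
  refine Fin.cases ?_ (fun j => ?_) i
  · simp
  · simpa using measurable_pi_apply j

theorem measurable_snoc (d : ℕ) :
    Measurable fun p : (Fin d → ℝ) × ℝ => (Fin.snoc p.1 p.2 : Fin (d + 1) → ℝ) := by
  refine measurable_pi_iff.2 fun i => ?_
  refine Fin.lastCases ?_ (fun j => ?_) i
  · simpa using measurable_snd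
  · simp only [Fin.snoc_castSucc]
    fun_prop

theorem _root_.Measurable.finSnoc {α : Type*} [MeasurableSpace α] {d : ℕ} {x : α → Fin d → ℝ}
    {y : α → ℝ} (hx : Measurable x) (hy : Measurable y) :
    Measurable fun a => (Fin.snoc (x a) (y a) : Fin (d + 1) → ℝ) :=
  (measurable_snoc d).comp (f := fun a => (x a, y a)) (hx.prodMk hy)

theorem measurable_killedProduct {d : ℕ} (t : Fin (d + 1) → ℝ) :
    Measurable fun p : ℝ × (Fin (d + 1) → ℝ) => killedProduct t p.2 p.1 := by
  unfold killedProduct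
  refine Finset.measurable_prod _ fun k _ => ?_
  exact Measurable.killedKernelAt (by fun_prop) _ (by fun_prop) (by fun_prop)

theorem measurable_killedProduct_cons_zero {d : ℕ} (t : Fin (d + 1) → ℝ) (b : ℝ) :
    Measurable fun z : Fin d → ℝ => killedProduct t (Fin.cons 0 z) b :=
  (measurable_killedProduct t).comp (measurable_const.prodMk (measurable_cons_zero d))
    (f := fun z : Fin d → ℝ => (b, (Fin.cons 0 z : Fin (d + 1) → ℝ)))

theorem killedProduct_nonneg {d : ℕ} {t : Fin (d + 1) → ℝ} (ht : Monotone t)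
    (z : Fin (d + 1) → ℝ) (b : ℝ) : 0 ≤ killedProduct t z b :=
  Finset.prod_nonneg fun k _ =>
    killedKernelAt_nonneg (sub_nonneg.2 (ht (Fin.castSucc_lt_succ (i := k)).le)) _ _ _

theorem killedProduct_snoc {d : ℕ} (t : Fin (d + 2) → ℝ) (x : Fin d → ℝ) (y b : ℝ) :
    killedProduct t (Fin.cons 0 (Fin.snoc x y : Fin (d + 1) → ℝ)) b =
      killedProduct (fun k => t k.castSucc) (Fin.cons 0 x) b *
        killedKernelAt b (t (Fin.last (d + 1)) - t (Fin.last d).castSucc)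
          ((Fin.cons 0 x : Fin (d + 1) → ℝ) (Fin.last d)) y := by
  unfold killedProduct
  rw [Fin.cons_snoc_eq_snoc_cons, Fin.prod_univ_castSucc]
  congr 1
  · refine Finset.prod_congr rfl fun k _ => ?_
    rw [Fin.snoc_castSucc, Fin.succ_castSucc, Fin.snoc_castSucc]
  · rw [Fin.snoc_castSucc, Fin.succ_last, Fin.snoc_last]

theorem lintegral_snoc {d : ℕ} {f : (Fin (d + 1) → ℝ) → ENNReal} (hf : Measurable f) :
    ∫⁻ z, f z = ∫⁻ x : Fin d → ℝ, ∫⁻ y : ℝ, f (Fin.snoc x y) := by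
  have h := (volume_preserving_piFinSuccAbove (fun _ : Fin (d + 1) => ℝ) (Fin.last d)).symm
  rw [← h.lintegral_comp hf, Measure.volume_eq_prod, lintegral_prod_symm']
  · refine lintegral_congr fun x => lintegral_congr fun y => congrArg f ?_
    exact Fin.insertNth_last' y x
  · exact hf.comp (MeasurableEquiv.measurable _)

/-- Splits survival up to `s + T` into survival up to `s` and a condition on the increments after
`s`, coupled only through the position `w s`. -/
theorem le_pathMin_add_iff {w : ℝ≥0 → ℝ} (hw : Continuous w) {s T : ℝ≥0} {b : ℝ} :
    b ≤ pathMin (s + T) w ↔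
      b ≤ pathMin s w ∧ b - w s ≤ pathMin T fun u => w (s + u) - w s := by
  have hw' : Continuous fun u => w (s + u) - w s := by fun_prop
  rw [le_pathMin_iff hw, le_pathMin_iff hw, le_pathMin_iff hw']
  constructor
  · intro h
    exact ⟨fun u hu => h u (hu.trans le_self_add), fun u hu => by
      linarith [h (s + u) (by gcongr)]⟩
  · rintro ⟨h1, h2⟩ u hu
    rcases le_total u s with h | h
    · exact h1 u h
    · have := h2 (u - s) (tsub_le_iff_left.2 hu)
      rw [add_tsub_cancel_of_le h] at this
      linarith

variable {Ω : Type*} [MeasurableSpace Ω] {P : Measure Ω} {X : ℝ≥0 → Ω → ℝ}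

/-- Independence of past and increments holds for the product σ-algebra, where the minimum over a
continuum need not be measurable. Continuity of paths replaces it by a countable infimum. -/
theorem IsRegularBrownian.indepFun_pathMin (hX : IsRegularBrownian X P) (s T : ℝ≥0) {d : ℕ}
    {t : Fin d → ℝ≥0} (ht : ∀ k, t k ≤ s) :
    IndepFun (fun ω => (pathMin s (X · ω), fun k => X (t k) ω))
      (fun ω => (pathMin T fun u => X (s + u) ω - X s ω, X (s + T) ω - X s ω)) P := by
  have hmem : ∀ n, s * ⟨TopologicalSpace.denseSeq I n, (TopologicalSpace.denseSeq I n).2.1⟩ ≤ s :=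
    fun n => mul_le_of_le_one_right' (by exact_mod_cast (TopologicalSpace.denseSeq I n).2.2)
  let Φ : (Set.Iic s → ℝ) → ℝ × (Fin d → ℝ) := fun p =>
    (⨅ n, p ⟨s * ⟨TopologicalSpace.denseSeq I n, (TopologicalSpace.denseSeq I n).2.1⟩, hmem n⟩,
      fun k => p ⟨t k, ht k⟩)
  let Ψ : (ℝ≥0 → ℝ) → ℝ × ℝ := fun p => (densePathMin T p, p T)
  have hΦ : Measurable Φ := by
    refine Measurable.prodMk (Measurable.iInf fun n => ?_) (measurable_pi_lambda _ fun k => ?_)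
    · exact measurable_pi_apply _
    · exact measurable_pi_apply _
  have hΨ : Measurable Ψ := (measurable_densePathMin T).prodMk (measurable_pi_apply _)
  convert (hX.indepFun_past_increment s).comp hΦ hΨ using 1
  · funext ω
    simp only [Function.comp, Φ, pathMin_eq_densePathMin (hX.continuous_path ω), densePathMin]
  · funext ω
    simp only [Function.comp, Ψ, pathMin_eq_densePathMin ((hX.shift s).continuous_path ω)]

theorem lintegral_comp_of_indepFun {α β : Type*} [MeasurableSpace α] [MeasurableSpace β]
    [IsFiniteMeasure P] {U : Ω → α} {V : Ω → β} (h : IndepFun U V P) (hU : Measurable U)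
    (hV : Measurable V) {g : α × β → ENNReal} (hg : Measurable g) :
    ∫⁻ ω, g (U ω, V ω) ∂P = ∫⁻ ω, ∫⁻ ω', g (U ω, V ω') ∂P ∂P := by
  rw [← lintegral_map (f := g) hg (hU.prodMk hV),
    (indepFun_iff_map_prod_eq_prod_map_map hU.aemeasurable hV.aemeasurable).1 h,
    lintegral_prod _ hg.aemeasurable, lintegral_map hg.lintegral_prod_right' hU]
  exact lintegral_congr fun ω => lintegral_map (hg.comp measurable_prodMk_left) hV

/-- The law of a Brownian motion at finitely many times, on the event that it stays above the
level `b`. -/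
theorem IsRegularBrownian.map_restrict_le_pathMin_pi (hX : IsRegularBrownian X P) {b : ℝ}
    (hb : b ≤ 0) : ∀ (d : ℕ) {t : Fin (d + 1) → ℝ≥0}, StrictMono t → t 0 = 0 →
    (P.restrict {ω | b ≤ pathMin (t (Fin.last d)) (X · ω)}).map
        (fun ω (k : Fin d) => X (t k.succ) ω) =
      volume.withDensity fun z : Fin d → ℝ =>
        ENNReal.ofReal (killedProduct (fun k => (t k : ℝ)) (Fin.cons 0 z) b)
  | 0, t, _, ht0 => by
    have := hX.isProbabilityMeasure
    -- With no times left the empty product is `1`, so the event must be everything; this is where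
    -- `b ≤ 0` enters.
    have hE : {ω | b ≤ pathMin (t (Fin.last 0)) (X · ω)} = Set.univ := by
      ext ω
      have h0 : t (Fin.last 0) = 0 := ht0
      simp only [Set.mem_ofPred_eq, Set.mem_univ, iff_true, h0,
        le_pathMin_iff (hX.continuous_path ω)]
      intro s hs
      have : s = 0 := by simpa using hs
      rw [this, hX.zero]
      exact hb
    have hm : Measurable (fun ω (k : Fin 0) => X (t k.succ) ω) :=
      measurable_pi_lambda _ fun _ => hX.meas _
    rw [hE, Measure.restrict_univ]
    have h1 : IsProbabilityMeasure (P.map (fun ω (k : Fin 0) => X (t k.succ) ω)) :=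
      Measure.isProbabilityMeasure_map hm.aemeasurable
    simp only [killedProduct, Finset.univ_eq_empty, Finset.prod_empty, ENNReal.ofReal_one]
    rw [show (fun _ : Fin 0 → ℝ => (1 : ENNReal)) = 1 from rfl, withDensity_one]
    ext A hA
    rcases Set.eq_empty_or_nonempty A with rfl | hne
    · simp
    · have : A = Set.univ := by
        obtain ⟨a, ha⟩ := hne
        exact Set.eq_univ_of_forall fun x => Subsingleton.elim a x ▸ ha
      rw [this, measure_univ]
      simp [volume_pi]
  | d + 1, t, ht, ht0 => by
    classical
    have := hX.isProbabilityMeasure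
    set s := t (Fin.last d).castSucc with hs
    set T := t (Fin.last (d + 1)) - s with hT
    have hlt : s < t (Fin.last (d + 1)) := ht (Fin.castSucc_lt_last _)
    have hsT : t (Fin.last (d + 1)) = s + T := (add_tsub_cancel_of_le hlt.le).symm
    have hT0 : T ≠ 0 := (tsub_pos_of_lt hlt).ne'
    have hTR : (t (Fin.last (d + 1)) : ℝ) - s = T := by
      rw [hsT]; push_cast; ring
    have IH := hX.map_restrict_le_pathMin_pi hb d (t := fun k => t k.castSucc)
      (fun i j hij => ht (by simpa using hij)) (by simpa using ht0)
    set x : Ω → Fin d → ℝ := fun ω k => X (t k.succ.castSucc) ω with hx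
    -- The position at time `s`; prepending `0` makes it meaningful for `d = 0` too.
    let l : (Fin d → ℝ) → ℝ := fun x => (Fin.cons 0 x : Fin (d + 1) → ℝ) (Fin.last d)
    have hl : Measurable l := (measurable_pi_apply _).comp (measurable_cons_zero d)
    have hlx : ∀ ω, l (x ω) = X s ω := by
      intro ω
      have : (Fin.cons 0 (x ω) : Fin (d + 1) → ℝ) = fun k => X (t k.castSucc) ω := by
        funext k
        refine Fin.cases ?_ (fun j => ?_) k
        · simp [ht0, hX.zero]
        · simp [hx]
      simp only [l, this, hs]
    have hxm : Measurable x := measurable_pi_lambda _ fun _ => hX.meas _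
    have hsnoc : ∀ ω, (fun k : Fin (d + 1) => X (t k.succ) ω) =
        Fin.snoc (x ω) (l (x ω) + (X (s + T) ω - X s ω)) := by
      intro ω
      rw [hlx, add_sub_cancel, ← hsT]
      funext k
      refine Fin.lastCases ?_ (fun j => ?_) k
      · simp
      · simp [hx]
    have hfull : Measurable fun ω (k : Fin (d + 1)) => X (t k.succ) ω :=
      measurable_pi_lambda _ fun _ => hX.meas _
    have hZ := hX.shift s
    refine Measure.ext_of_lintegral _ fun f hf => ?_
    rw [lintegral_map hf hfull, lintegral_withDensity_eq_lintegral_mul _ _ hf,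
      ← lintegral_indicator (measurableSet_le measurable_const (hX.measurable_pathMin _))]
    swap
    · exact (measurable_killedProduct_cons_zero _ _).ennreal_ofReal
    let g : (ℝ × (Fin d → ℝ)) × (ℝ × ℝ) → ENNReal := fun p =>
      if b ≤ p.1.1 then
        if b - l p.1.2 ≤ p.2.1 then f (Fin.snoc p.1.2 (l p.1.2 + p.2.2)) else 0
      else 0
    have hg : Measurable g := by
      refine Measurable.ite (measurableSet_le measurable_const (by fun_prop)) (Measurable.ite
        (measurableSet_le (by fun_prop) (by fun_prop)) ?_ measurable_const) measurable_const
      exact hf.comp (Measurable.finSnoc (by fun_prop) (by fun_prop))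
    let U : Ω → ℝ × (Fin d → ℝ) := fun ω => (pathMin s (X · ω), x ω)
    let V : Ω → ℝ × ℝ := fun ω => (pathMin T fun u => X (s + u) ω - X s ω, X (s + T) ω - X s ω)
    have hU : Measurable U := (hX.measurable_pathMin s).prodMk hxm
    have hV : Measurable V := (hZ.measurable_pathMin T).prodMk (hZ.meas T)
    have hind : IndepFun U V P := hX.indepFun_pathMin s T fun k => ht.monotone (by simp)
    have h1 : ∀ ω, ({ω | b ≤ pathMin (t (Fin.last (d + 1))) (X · ω)}.indicator
        (fun ω => f fun k : Fin (d + 1) => X (t k.succ) ω)) ω = g (U ω, V ω) := by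
      intro ω
      simp only [Set.indicator_apply, Set.mem_ofPred_eq, hsT,
        le_pathMin_add_iff (hX.continuous_path ω), hsnoc, g, U, V, hlx, ite_and]
    have h2 := lintegral_comp_of_indepFun hind hU hV hg
    -- The result of freezing the past and integrating over the last step only; the induction
    -- hypothesis is then applied to `F`.
    let F : (Fin d → ℝ) → ENNReal := fun x =>
      ∫⁻ y, ENNReal.ofReal (killedKernelAt b T (l x) y) * f (Fin.snoc x y)
    have hF : Measurable F := by
      refine Measurable.lintegral_prod_right' (f := fun p : (Fin d → ℝ) × ℝ =>
        ENNReal.ofReal (killedKernelAt b T (l p.1) p.2) * f (Fin.snoc p.1 p.2)) ?_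
      refine Measurable.mul ?_ (hf.comp (measurable_snoc d))
      exact (Measurable.killedKernelAt measurable_const _ (hl.comp measurable_fst)
        measurable_snd).ennreal_ofReal
    have h3 : ∀ m x, ∫⁻ ω', g ((m, x), V ω') ∂P = if b ≤ m then F x else 0 := by
      intro m x
      by_cases hm : b ≤ m
      · have hfm : Measurable fun y => f (Fin.snoc x (l x + y)) :=
          hf.comp (Measurable.finSnoc (by fun_prop) (by fun_prop))
        have hR := congrArg (fun μ => ∫⁻ y, f (Fin.snoc x (l x + y)) ∂μ)
          (hZ.map_restrict_le_pathMin hT0 (b - l x))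
        beta_reduce at hR
        rw [lintegral_map hfm (hZ.meas T), ← lintegral_indicator
          (measurableSet_le measurable_const (hZ.measurable_pathMin T)),
          lintegral_withDensity_eq_lintegral_mul _ _ hfm] at hR
        swap
        · exact ((measurable_killedKernelAt T).comp
            (measurable_const.prodMk (measurable_const.prodMk measurable_id))).ennreal_ofReal
        simp only [if_pos hm, g, F]
        rw [← lintegral_add_left_eq_self _ (l x)]
        simp only [Set.indicator_apply, Set.mem_ofPred_eq, Pi.mul_apply,
          killedKernelAt_sub_left] at hR
        exact hR
      · simp [g, hm]
    rw [lintegral_congr h1, h2]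
    simp only [U, h3]
    have h4 := congrArg (fun μ => ∫⁻ x, F x ∂μ) IH
    beta_reduce at h4
    rw [lintegral_map hF hxm, ← lintegral_indicator
      (measurableSet_le measurable_const (hX.measurable_pathMin _)),
      lintegral_withDensity_eq_lintegral_mul _ _ hF] at h4
    swap
    · exact (measurable_killedProduct_cons_zero _ _).ennreal_ofReal
    simp only [Set.indicator_apply, Set.mem_ofPred_eq, ← hs, Pi.mul_apply] at h4
    rw [h4, lintegral_snoc]
    swap
    · exact ((measurable_killedProduct_cons_zero _ _).ennreal_ofReal).mul hf
    refine lintegral_congr fun x => ?_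
    simp only [F]
    rw [← lintegral_const_mul' _ _ ENNReal.ofReal_ne_top]
    refine lintegral_congr fun y => ?_
    rw [Pi.mul_apply, killedProduct_snoc, ENNReal.ofReal_mul, hTR, mul_assoc]
    exact killedProduct_nonneg (fun i j hij => by
      exact_mod_cast ht.monotone (by simpa using hij)) _ _

end Markov

section Calculus

/-! ### Dependence of the killed kernels on the level -/

/-- The smooth extension in `b` of the killed kernel `q_t^{(b)}(x,y)`. -/
noncomputable def reflKernel (b t x y : ℝ) : ℝ :=
  1 / Real.sqrt (2 * Real.pi * t) *
    (Real.exp (-(1 / (2 * t)) * (x - b - (y - b)) ^ 2) -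
      Real.exp (-(1 / (2 * t)) * (x - b + (y - b)) ^ 2))

/-- The derivative of `-q_t^{(b)}(x,y)` in `b`. -/
noncomputable def kernelSlope (b t x y : ℝ) : ℝ :=
  1 / Real.sqrt (2 * Real.pi * t) *
    (2 / t * (x + y - 2 * b) * Real.exp (-(1 / (2 * t)) * (x - b + (y - b)) ^ 2))

/-- Moving the level does not change `x - y`, so only the image term contributes. -/
theorem hasDerivAt_reflKernel (b t x y : ℝ) :
    HasDerivAt (fun b => reflKernel b t x y) (-kernelSlope b t x y) b := by
  have h1 : HasDerivAt (fun b : ℝ => -(1 / (2 * t)) * (x - b - (y - b)) ^ 2) 0 b := by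
    have : (fun b : ℝ => -(1 / (2 * t)) * (x - b - (y - b)) ^ 2) =
        fun _ => -(1 / (2 * t)) * (x - y) ^ 2 := by
      funext b; ring
    rw [this]
    exact hasDerivAt_const _ _
  have h2 : HasDerivAt (fun b : ℝ => -(1 / (2 * t)) * (x - b + (y - b)) ^ 2)
      (2 / t * (x + y - 2 * b)) b := by
    have h := ((((hasDerivAt_id b).const_sub x).add ((hasDerivAt_id b).const_sub y)).pow 2).const_mul
      (-(1 / (2 * t)))
    refine h.congr_deriv ?_
    simp only [id, Pi.add_apply]
    push_cast
    ring
  refine ((h1.exp.sub h2.exp).const_mul (1 / Real.sqrt (2 * Real.pi * t))).congr_deriv ?_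
  unfold kernelSlope
  ring

theorem continuous_kernelSlope (t x y : ℝ) : Continuous fun b => kernelSlope b t x y := by
  unfold kernelSlope
  fun_prop

theorem continuous_reflKernel (t x y : ℝ) : Continuous fun b => reflKernel b t x y := by
  unfold reflKernel
  fun_prop

theorem reflKernel_eq_killedKernelAt {b t x y : ℝ} (hx : b < x) (hy : b < y) :
    reflKernel b t x y = killedKernelAt b t x y := by
  unfold killedKernelAt killedKernel reflKernel
  rw [if_pos ⟨sub_pos.2 hx, sub_pos.2 hy⟩]

/-- Dirichlet boundary condition: at the level, the direct and image Gaussians cancel. -/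
theorem reflKernel_self_left (t x y : ℝ) : reflKernel x t x y = 0 := by
  rw [reflKernel, show x - x - (y - x) = -(x - x + (y - x)) by ring, neg_sq]
  simp

theorem reflKernel_self_right (t x y : ℝ) : reflKernel y t x y = 0 := by
  rw [reflKernel, show x - y - (y - y) = x - y + (y - y) by ring]
  simp

theorem reflKernel_nonneg {b t x y : ℝ} (ht : 0 ≤ t) (hx : b ≤ x) (hy : b ≤ y) :
    0 ≤ reflKernel b t x y := by
  refine mul_nonneg (by positivity) (sub_nonneg.2 (Real.exp_le_exp.2 ?_))
  refine mul_le_mul_of_nonpos_left ?_ (by simpa using ht)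
  nlinarith [mul_nonneg (sub_nonneg.2 hx) (sub_nonneg.2 hy)]

theorem kernelSlope_nonneg {b t x y : ℝ} (ht : 0 ≤ t) (hx : b ≤ x) (hy : b ≤ y) :
    0 ≤ kernelSlope b t x y := by
  have : 0 ≤ x + y - 2 * b := by linarith
  unfold kernelSlope
  positivity

theorem abs_reflKernel_le {t : ℝ} (ht : 0 ≤ t) (b x y : ℝ) :
    |reflKernel b t x y| ≤ 1 / Real.sqrt (2 * Real.pi * t) := by
  have h : ∀ u : ℝ, Real.exp (-(1 / (2 * t)) * u ^ 2) ≤ 1 := fun u =>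
    Real.exp_le_one_iff.2 (by
      have : 0 ≤ 1 / (2 * t) * u ^ 2 := by positivity
      linarith)
  unfold reflKernel
  rw [abs_mul, abs_of_nonneg (by positivity : 0 ≤ 1 / Real.sqrt (2 * Real.pi * t))]
  refine mul_le_of_le_one_right (by positivity) ?_
  rw [abs_le]
  constructor <;>
    linarith [h (x - b - (y - b)), h (x - b + (y - b)),
      Real.exp_pos (-(1 / (2 * t)) * (x - b - (y - b)) ^ 2),
      Real.exp_pos (-(1 / (2 * t)) * (x - b + (y - b)) ^ 2)]

/-- Complete the square and translate by `β / (2 * α)`. -/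
theorem integrable_affine_mul_exp_quadratic {α : ℝ} (hα : 0 < α) (p q β γ : ℝ) :
    Integrable fun u : ℝ => (p + q * u) * Real.exp (-α * u ^ 2 + β * u + γ) := by
  have h1 : Integrable fun u : ℝ =>
      (p + q * (β / (2 * α))) * Real.exp (γ + β ^ 2 / (4 * α)) * Real.exp (-α * u ^ 2) +
        q * Real.exp (γ + β ^ 2 / (4 * α)) * (u * Real.exp (-α * u ^ 2)) :=
    ((integrable_exp_neg_mul_sq hα).const_mul _).add
      ((integrable_mul_exp_neg_mul_sq hα).const_mul _)
  refine (h1.comp_sub_right (β / (2 * α))).congr (Eventually.of_forall fun u => ?_)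
  have e : -α * u ^ 2 + β * u + γ = (γ + β ^ 2 / (4 * α)) + -α * (u - β / (2 * α)) ^ 2 := by
    field_simp
    ring
  simp only
  rw [e, Real.exp_add (γ + β ^ 2 / (4 * α))]
  ring

theorem integrable_exp_mul_kernelSlope {t : ℝ} (ht : 0 < t) (x y γ δ : ℝ) :
    Integrable fun b => Real.exp (γ * b + δ) * kernelSlope b t x y := by
  -- Expanding `(x + y - 2 * b) ^ 2 / (2 * t)` in `b` gives leading coefficient `2 / t`, so the
  -- Gaussian decay dominates any exponential tilt.
  have h := integrable_affine_mul_exp_quadratic (α := 2 / t) (by positivity)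
    (1 / Real.sqrt (2 * Real.pi * t) * (2 / t * (x + y)))
    (1 / Real.sqrt (2 * Real.pi * t) * (2 / t * (-2))) (2 / t * (x + y) + γ)
    (δ - (x + y) ^ 2 / (2 * t))
  refine h.congr (Eventually.of_forall fun b => ?_)
  have e : -(2 / t) * b ^ 2 + (2 / t * (x + y) + γ) * b + (δ - (x + y) ^ 2 / (2 * t)) =
      (γ * b + δ) + -(1 / (2 * t)) * (x - b + (y - b)) ^ 2 := by
    field_simp
    ring
  simp only [kernelSlope]
  rw [e, Real.exp_add]
  ring

variable {d : ℕ}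

theorem lt_minValue_iff {z : Fin (d + 1) → ℝ} {b : ℝ} : b < minValue z ↔ ∀ k, b < z k := by
  simp [minValue, Finset.lt_inf'_iff]

theorem le_minValue_iff {z : Fin (d + 1) → ℝ} {b : ℝ} : b ≤ minValue z ↔ ∀ k, b ≤ z k := by
  simp [minValue, Finset.le_inf'_iff]

theorem exists_eq_minValue (z : Fin (d + 1) → ℝ) : ∃ k, z k = minValue z := by
  obtain ⟨k, _, hk⟩ := Finset.exists_mem_eq_inf' Finset.univ_nonempty z
  exact ⟨k, hk.symm⟩

/-- The smooth extension in `b` of `killedProduct`. -/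
noncomputable def reflProduct (t z : Fin (d + 1) → ℝ) (b : ℝ) : ℝ :=
  ∏ k : Fin d, reflKernel b (t k.succ - t k.castSucc) (z k.castSucc) (z k.succ)

/-- The derivative of `-reflProduct` in `b`. -/
noncomputable def productSlope (t z : Fin (d + 1) → ℝ) (b : ℝ) : ℝ :=
  ∑ k : Fin d, (∏ j ∈ Finset.univ.erase k,
    reflKernel b (t j.succ - t j.castSucc) (z j.castSucc) (z j.succ)) *
      kernelSlope b (t k.succ - t k.castSucc) (z k.castSucc) (z k.succ)

theorem hasDerivAt_reflProduct (t z : Fin (d + 1) → ℝ) (b : ℝ) :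
    HasDerivAt (reflProduct t z) (-productSlope t z b) b := by
  have h := HasDerivAt.fun_finsetProd (u := Finset.univ) (x := b)
    (f := fun (k : Fin d) b => reflKernel b (t k.succ - t k.castSucc) (z k.castSucc) (z k.succ))
    fun k _ => hasDerivAt_reflKernel b _ _ _
  refine h.congr_deriv ?_
  simp only [productSlope, smul_eq_mul, mul_neg, Finset.sum_neg_distrib]

theorem continuous_productSlope (t z : Fin (d + 1) → ℝ) : Continuous (productSlope t z) :=
  continuous_finsetSum _ fun _ _ => (continuous_finsetProd _ fun _ _ =>
    continuous_reflKernel _ _ _).mul (continuous_kernelSlope _ _ _)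

theorem reflProduct_eq_killedProduct {t z : Fin (d + 1) → ℝ} {b : ℝ} (hb : b < minValue z) :
    reflProduct t z b = killedProduct t z b := by
  rw [lt_minValue_iff] at hb
  exact Finset.prod_congr rfl fun k _ => reflKernel_eq_killedKernelAt (hb _) (hb _)

theorem hasDerivAt_killedProduct (t z : Fin (d + 1) → ℝ) {b : ℝ} (hb : b < minValue z) :
    HasDerivAt (killedProduct t z) (-productSlope t z b) b := by
  refine (hasDerivAt_reflProduct t z b).congr_of_eventuallyEq ?_
  filter_upwards [gt_mem_nhds hb] with u hu using (reflProduct_eq_killedProduct hu).symm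

theorem densityIntegrand_eq (a c : ℝ) (t z : Fin (d + 1) → ℝ) {b : ℝ} (hb : b < minValue z) :
    densityIntegrand a c t z b =
      Real.exp ((a + c) * b - a * z (Fin.last d)) * productSlope t z b := by
  rw [densityIntegrand, (hasDerivAt_killedProduct t z hb).deriv, neg_neg]

theorem productSlope_nonneg {t z : Fin (d + 1) → ℝ} (ht : Monotone t) {b : ℝ}
    (hb : b ≤ minValue z) : 0 ≤ productSlope t z b := by
  rw [le_minValue_iff] at hb
  have ht' : ∀ k : Fin d, 0 ≤ t k.succ - t k.castSucc := fun k =>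
    sub_nonneg.2 (ht (Fin.castSucc_lt_succ (i := k)).le)
  exact Finset.sum_nonneg fun k _ => mul_nonneg
    (Finset.prod_nonneg fun j _ => reflKernel_nonneg (ht' j) (hb _) (hb _))
    (kernelSlope_nonneg (ht' k) (hb _) (hb _))

/-- Each summand has one slope with Gaussian decay in `b`; its other factors are bounded uniformly
in `b`. Hence integrability holds on the whole line and for either sign of `γ`. -/
theorem integrable_exp_mul_productSlope {t : Fin (d + 1) → ℝ} (ht : StrictMono t)
    (z : Fin (d + 1) → ℝ) (γ δ : ℝ) :
    Integrable fun b => Real.exp (γ * b + δ) * productSlope t z b := by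
  have ht' : ∀ k : Fin d, 0 < t k.succ - t k.castSucc := fun k =>
    sub_pos.2 (ht (Fin.castSucc_lt_succ (i := k)))
  have : (fun b => Real.exp (γ * b + δ) * productSlope t z b) = fun b => ∑ k : Fin d,
      (∏ j ∈ Finset.univ.erase k,
        reflKernel b (t j.succ - t j.castSucc) (z j.castSucc) (z j.succ)) *
      (Real.exp (γ * b + δ) *
        kernelSlope b (t k.succ - t k.castSucc) (z k.castSucc) (z k.succ)) := by
    funext b
    rw [productSlope, Finset.mul_sum]
    exact Finset.sum_congr rfl fun k _ => by ring
  rw [this]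
  refine integrable_finsetSum _ fun k _ => ?_
  refine (integrable_exp_mul_kernelSlope (ht' k) _ _ γ δ).bdd_mul
    (c := ∏ j ∈ Finset.univ.erase k, 1 / Real.sqrt (2 * Real.pi * (t j.succ - t j.castSucc)))
    (continuous_finsetProd _ fun _ _ => continuous_reflKernel _ _ _).aestronglyMeasurable
    (Eventually.of_forall fun b => ?_)
  rw [norm_prod]
  exact Finset.prod_le_prod (fun _ _ => norm_nonneg _) fun j _ => abs_reflKernel_le (ht' j).le _ _ _

theorem integrableOn_densityIntegrand (a c : ℝ) {t : Fin (d + 1) → ℝ} (ht : StrictMono t)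
    (z : Fin (d + 1) → ℝ) :
    IntegrableOn (densityIntegrand a c t z) (Set.Iic (minValue z)) := by
  -- The formula for the derivative is available only strictly below the minimum; the endpoint is a
  -- null set.
  rw [integrableOn_Iic_iff_integrableOn_Iio]
  refine (integrable_exp_mul_productSlope ht z (a + c)
    (-(a * z (Fin.last d)))).integrableOn.congr_fun (fun b hb => ?_) measurableSet_Iio
  rw [densityIntegrand_eq a c t z hb, sub_eq_add_neg]

/-- Every coordinate of `z` occurs in one of the factors of the product of kernels. -/
theorem exists_factor (hd : d ≠ 0) (i : Fin (d + 1)) :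
    ∃ k : Fin d, i = k.castSucc ∨ i = k.succ := by
  obtain ⟨n, rfl⟩ := Nat.exists_eq_succ_of_ne_zero hd
  refine Fin.cases ⟨0, Or.inl rfl⟩ (fun k => ⟨k, Or.inr rfl⟩) i

/-- The coordinate attaining the minimum is an endpoint of some factor, and that factor vanishes
there. For `d = 0` there is no factor. -/
theorem reflProduct_minValue (hd : d ≠ 0) (t z : Fin (d + 1) → ℝ) :
    reflProduct t z (minValue z) = 0 := by
  obtain ⟨i, hi⟩ := exists_eq_minValue z
  obtain ⟨k, hk⟩ := exists_factor hd i
  refine Finset.prod_eq_zero (Finset.mem_univ k) ?_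
  rw [← hi]
  rcases hk with rfl | rfl
  · exact reflKernel_self_left _ _ _
  · exact reflKernel_self_right _ _ _

theorem killedProduct_eq_zero (hd : d ≠ 0) (t : Fin (d + 1) → ℝ) {z : Fin (d + 1) → ℝ} {b : ℝ}
    (hb : minValue z ≤ b) : killedProduct t z b = 0 := by
  obtain ⟨i, hi⟩ := exists_eq_minValue z
  obtain ⟨k, hk⟩ := exists_factor hd i
  refine Finset.prod_eq_zero (Finset.mem_univ k) (killedKernelAt_eq_zero_of_le ?_)
  rw [← hi] at hb
  rcases hk with rfl | rfl
  · exact Or.inl hb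
  · exact Or.inr hb

theorem measurable_productSlope (t : Fin (d + 1) → ℝ) :
    Measurable fun p : ℝ × (Fin (d + 1) → ℝ) => productSlope t p.2 p.1 := by
  unfold productSlope kernelSlope reflKernel
  fun_prop

/-- The joint density of the minimum of Brownian motion and of its values at the times
`t_1, …, t_d`. -/
noncomputable def minJointDensity (t : Fin (d + 1) → ℝ) (p : ℝ × (Fin d → ℝ)) : ENNReal :=
  open Classical in
  if p.1 < minValue (Fin.cons 0 p.2) then
    ENNReal.ofReal (productSlope t (Fin.cons 0 p.2) p.1) else 0

theorem measurableSet_lt_minValue_cons :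
    MeasurableSet {p : ℝ × (Fin d → ℝ) | p.1 < minValue (Fin.cons 0 p.2)} := by
  have : {p : ℝ × (Fin d → ℝ) | p.1 < minValue (Fin.cons 0 p.2)} =
      ⋂ k, {p | p.1 < (Fin.cons 0 p.2 : Fin (d + 1) → ℝ) k} := by
    ext p
    simp [lt_minValue_iff]
  rw [this]
  exact MeasurableSet.iInter fun k => measurableSet_lt measurable_fst
    ((measurable_pi_apply k).comp ((measurable_cons_zero d).comp measurable_snd))

theorem measurable_productSlope_cons_zero (t : Fin (d + 1) → ℝ) :
    Measurable fun p : ℝ × (Fin d → ℝ) => productSlope t (Fin.cons 0 p.2) p.1 :=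
  (measurable_productSlope t).comp
    (f := fun p : ℝ × (Fin d → ℝ) => (p.1, (Fin.cons 0 p.2 : Fin (d + 1) → ℝ)))
    (measurable_fst.prodMk ((measurable_cons_zero d).comp measurable_snd))

theorem measurable_minJointDensity (t : Fin (d + 1) → ℝ) : Measurable (minJointDensity t) := by
  classical
  exact Measurable.ite measurableSet_lt_minValue_cons
    (measurable_productSlope_cons_zero t).ennreal_ofReal measurable_const

/-- Fundamental theorem of calculus from `b` to the least coordinate, where the smooth extension
vanishes and leaves no upper boundary term. -/
theorem setLIntegral_minJointDensity (hd : d ≠ 0) {t : Fin (d + 1) → ℝ} (ht : Monotone t)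
    (b : ℝ) (z : Fin d → ℝ) :
    ∫⁻ m in Set.Ici b, minJointDensity t (m, z) =
      ENNReal.ofReal (killedProduct t (Fin.cons 0 z) b) := by
  classical
  set w : Fin (d + 1) → ℝ := Fin.cons 0 z
  have h1 : ∫⁻ m in Set.Ici b, minJointDensity t (m, z) =
      ∫⁻ m in Set.Ico b (minValue w), ENNReal.ofReal (productSlope t w m) := by
    rw [← lintegral_indicator measurableSet_Ici, ← lintegral_indicator measurableSet_Ico]
    refine lintegral_congr fun m => ?_
    simp only [Set.indicator_apply, Set.mem_Ici, Set.mem_Ico, minJointDensity, ite_and, w]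
  rw [h1]
  rcases le_or_gt (minValue w) b with h | h
  · rw [killedProduct_eq_zero hd t h, Set.Ico_eq_empty (not_lt.2 h)]
    simp
  · rw [← ofReal_integral_eq_lintegral_ofReal, integral_Ico_eq_integral_Ioc,
      ← intervalIntegral.integral_of_le h.le]
    · have := intervalIntegral.integral_eq_sub_of_hasDerivAt (a := b) (b := minValue w)
        (f := reflProduct t w) (fun x _ => hasDerivAt_reflProduct t w x)
        ((continuous_productSlope t w).neg.intervalIntegrable _ _)
      rw [intervalIntegral.integral_neg, reflProduct_minValue hd,
        reflProduct_eq_killedProduct h] at this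
      congr 1
      linarith
    · exact ((continuous_productSlope t w).integrableOn_Icc (a := b) (b := minValue w)).mono_set
        Set.Ico_subset_Icc_self
    · filter_upwards [ae_restrict_mem measurableSet_Ico] with m hm
      exact productSlope_nonneg ht hm.2.le

end Calculus

/-! ### Joint law of the minimum and of finitely many values -/

section JointLaw

variable {Ω : Type*} [MeasurableSpace Ω] {P : Measure Ω} {X : ℝ≥0 → Ω → ℝ} {d : ℕ}

/-- The joint law of the minimum of a Brownian motion and of its values at finitely many times. -/
theorem IsRegularBrownian.map_pathMin_prod (hX : IsRegularBrownian X P) (hd : d ≠ 0)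
    {t : Fin (d + 1) → ℝ≥0} (ht : StrictMono t) (ht0 : t 0 = 0) :
    P.map (fun ω => (pathMin (t (Fin.last d)) (X · ω), fun k : Fin d => X (t k.succ) ω)) =
      (volume.prod volume).withDensity (minJointDensity fun k => (t k : ℝ)) := by
  have := hX.isProbabilityMeasure
  set M : Ω → ℝ := fun ω => pathMin (t (Fin.last d)) (X · ω)
  set x : Ω → Fin d → ℝ := fun ω k => X (t k.succ) ω
  have hM : Measurable M := hX.measurable_pathMin _
  have hx : Measurable x := measurable_pi_lambda _ fun _ => hX.meas _
  have htm : Monotone fun k => (t k : ℝ) := fun i j hij => by exact_mod_cast ht.monotone hij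
  set μ := P.map fun ω => (M ω, x ω)
  set ν := (volume.prod volume).withDensity (minJointDensity fun k => (t k : ℝ))
  have hμ : IsProbabilityMeasure μ := Measure.isProbabilityMeasure_map (hM.prodMk hx).aemeasurable
  have key : ∀ (b : ℝ) {A : Set (Fin d → ℝ)}, MeasurableSet A →
      μ (Set.Ici b ×ˢ A) = ν (Set.Ici b ×ˢ A) := by
    intro b A hA
    have h1 : ν (Set.Ici b ×ˢ A) = ∫⁻ z in A,
        ENNReal.ofReal (killedProduct (fun k => (t k : ℝ)) (Fin.cons 0 z) b) := by
      rw [withDensity_apply _ (measurableSet_Ici.prod hA), ← Measure.prod_restrict,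
        lintegral_prod_symm' _ (measurable_minJointDensity _)]
      exact lintegral_congr fun z => setLIntegral_minJointDensity hd htm b z
    have h2 : μ (Set.Ici b ×ˢ A) = (P.restrict {ω | b ≤ M ω}).map x A := by
      rw [Measure.map_apply (hM.prodMk hx) (measurableSet_Ici.prod hA), Measure.map_apply hx hA,
        Measure.restrict_apply (hx hA)]
      congr 1
      ext ω
      simp [and_comm]
    rw [h1, h2]
    rcases le_or_gt b 0 with hb | hb
    · rw [hX.map_restrict_le_pathMin_pi hb d ht ht0, withDensity_apply _ hA]
    · have hE : {ω | b ≤ M ω} = ∅ := by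
        ext ω
        have := (le_pathMin_iff (hX.continuous_path ω)).1 (le_refl (M ω)) 0 zero_le
        rw [hX.zero] at this
        simpa using this.trans_lt hb
      have hz : ∀ z : Fin d → ℝ, killedProduct (fun k => (t k : ℝ)) (Fin.cons 0 z) b = 0 := by
        intro z
        refine killedProduct_eq_zero hd _ ?_
        exact ((le_minValue_iff.1 le_rfl 0).trans_eq (Fin.cons_zero _ _)).trans hb.le
      simp [hE, hz]
  -- For fixed `A`, both sides are measures in the first factor `s`, and `key` identifies them on
  -- the half-lines `[b, ∞)`.
  refine Measure.ext_prod fun {s A} hs hA => ?_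
  have hs' : ∀ (ρ : Measure (ℝ × (Fin d → ℝ))) {s : Set ℝ}, MeasurableSet s →
      (ρ.restrict (Set.univ ×ˢ A)).map Prod.fst s = ρ (s ×ˢ A) := by
    intro ρ s hs
    rw [Measure.map_apply measurable_fst hs, Measure.restrict_apply (measurable_fst hs)]
    congr 1
    ext p
    simp
  rw [← hs' μ hs, ← hs' ν hs]
  congr 1
  refine Measure.ext_of_Ici _ _ fun b => ?_
  rw [hs' μ measurableSet_Ici, hs' ν measurableSet_Ici, key b hA]

end JointLaw

section Normalisation

/-! ### The normalising constant -/

theorem integrable_exp_quadratic (a : ℝ) :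
    Integrable fun s : ℝ => Real.exp (-(1 / 2) * s ^ 2 - a * s) := by
  refine (integrable_affine_mul_exp_quadratic (α := 1 / 2) (by norm_num) 1 0 (-a) 0).congr
    (Eventually.of_forall fun s => ?_)
  simp only
  ring_nf

theorem integrable_id_mul_exp_quadratic (a : ℝ) :
    Integrable fun s : ℝ => s * Real.exp (-(1 / 2) * s ^ 2 - a * s) := by
  refine (integrable_affine_mul_exp_quadratic (α := 1 / 2) (by norm_num) 0 1 (-a) 0).congr
    (Eventually.of_forall fun s => ?_)
  simp only
  ring_nf

theorem integrable_sq_mul_exp_quadratic (a : ℝ) :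
    Integrable fun s : ℝ => s ^ 2 * Real.exp (-(1 / 2) * s ^ 2 - a * s) := by
  -- Half of the Gaussian decay absorbs the square, through `s ^ 2 / 4 ≤ exp (s ^ 2 / 4)`.
  refine ((integrable_affine_mul_exp_quadratic (α := 1 / 4) (by norm_num) 4 0 (-a) 0)).mono'
    (by fun_prop) (Eventually.of_forall fun s => ?_)
  rw [Real.norm_eq_abs, abs_of_nonneg (by positivity)]
  have h1 : s ^ 2 / 4 ≤ Real.exp (s ^ 2 / 4) := by linarith [Real.add_one_le_exp (s ^ 2 / 4)]
  have h2 : Real.exp (-(1 / 4) * s ^ 2 + -a * s + 0) =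
      Real.exp (s ^ 2 / 4) * Real.exp (-(1 / 2) * s ^ 2 - a * s) := by
    rw [← Real.exp_add]
    ring_nf
  rw [h2]
  nlinarith [Real.exp_pos (-(1 / 2) * s ^ 2 - a * s)]

theorem hasDerivAt_exp_quadratic (a s : ℝ) :
    HasDerivAt (fun s : ℝ => Real.exp (-(1 / 2) * s ^ 2 - a * s))
      (-(s * Real.exp (-(1 / 2) * s ^ 2 - a * s)) -
        a * Real.exp (-(1 / 2) * s ^ 2 - a * s)) s := by
  have h : HasDerivAt (fun s : ℝ => -(1 / 2) * s ^ 2 - a * s) (-s - a) s := by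
    refine ((((hasDerivAt_id s).pow 2).const_mul (-(1 / 2))).sub
      ((hasDerivAt_id s).const_mul a)).congr_deriv ?_
    simp only [id]
    push_cast
    ring
  exact h.exp.congr_deriv (by ring)

/-- Integrability of both `f` and its derivative forces `f` to vanish at infinity, so only the
boundary term at `0` remains. -/
theorem integral_Ioi_eq_neg_of_hasDerivAt {f f' : ℝ → ℝ} (hf : ∀ x, HasDerivAt f (f' x) x)
    (hi : Integrable f) (hi' : Integrable f') : ∫ x in Set.Ioi 0, f' x = -f 0 := by
  have h0 := tendsto_zero_of_hasDerivAt_of_integrableOn_Ioi (a := 0) (fun x _ => hf x)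
    hi'.integrableOn hi.integrableOn
  rw [integral_Ioi_of_hasDerivAt_of_tendsto (hf 0).continuousAt.continuousWithinAt
    (fun x _ => hf x) hi'.integrableOn h0, zero_sub]

theorem integral_id_mul_exp_quadratic (a : ℝ) :
    ∫ s in Set.Ioi (0 : ℝ), s * Real.exp (-(1 / 2) * s ^ 2 - a * s) =
      1 - a * ∫ s in Set.Ioi (0 : ℝ), Real.exp (-(1 / 2) * s ^ 2 - a * s) := by
  have i1 : Integrable fun s : ℝ => -(s * Real.exp (-(1 / 2) * s ^ 2 - a * s)) :=
    (integrable_id_mul_exp_quadratic a).neg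
  have h := integral_Ioi_eq_neg_of_hasDerivAt (hasDerivAt_exp_quadratic a)
    (integrable_exp_quadratic a) (i1.sub ((integrable_exp_quadratic a).const_mul a))
  rw [integral_sub i1.integrableOn
    ((integrable_exp_quadratic a).const_mul a).integrableOn, integral_neg,
    integral_const_mul] at h
  simp only [ne_eq, OfNat.ofNat_ne_zero, not_false_eq_true, zero_pow, mul_zero, sub_zero,
    Real.exp_zero] at h
  linarith

/-- Integration by parts: integrate the derivative of `s * exp (-s ^ 2 / 2 - a * s)`, whose boundary
terms vanish. -/
theorem integral_sq_mul_exp_quadratic (a : ℝ) :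
    ∫ s in Set.Ioi (0 : ℝ), s ^ 2 * Real.exp (-(1 / 2) * s ^ 2 - a * s) =
      (1 + a ^ 2) * (∫ s in Set.Ioi (0 : ℝ), Real.exp (-(1 / 2) * s ^ 2 - a * s)) - a := by
  have hd : ∀ s : ℝ, HasDerivAt (fun s => s * Real.exp (-(1 / 2) * s ^ 2 - a * s))
      (Real.exp (-(1 / 2) * s ^ 2 - a * s) - s ^ 2 * Real.exp (-(1 / 2) * s ^ 2 - a * s) -
        a * (s * Real.exp (-(1 / 2) * s ^ 2 - a * s))) s := fun s =>
    ((hasDerivAt_id s).mul (hasDerivAt_exp_quadratic a s)).congr_deriv (by simp only [id]; ring)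
  have i0 := integrable_exp_quadratic a
  have i1 := integrable_id_mul_exp_quadratic a
  have i2 := integrable_sq_mul_exp_quadratic a
  have i02 : Integrable fun s : ℝ => Real.exp (-(1 / 2) * s ^ 2 - a * s) -
      s ^ 2 * Real.exp (-(1 / 2) * s ^ 2 - a * s) := i0.sub i2
  have h := integral_Ioi_eq_neg_of_hasDerivAt hd i1 (i02.sub (i1.const_mul a))
  rw [integral_sub i02.integrableOn (i1.const_mul a).integrableOn,
    integral_sub i0.integrableOn i2.integrableOn, integral_const_mul,
    integral_id_mul_exp_quadratic] at h
  linarith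

/-- Complete the square and substitute `v = (s + a) / √2`. -/
theorem integral_exp_quadratic (a : ℝ) :
    ∫ s in Set.Ioi (0 : ℝ), Real.exp (-(1 / 2) * s ^ 2 - a * s) =
      Real.sqrt (Real.pi / 2) * expErfc (a / Real.sqrt 2) := by
  have h2 : (0 : ℝ) < Real.sqrt 2 := by positivity
  have hsq : Real.sqrt 2 ^ 2 = 2 := Real.sq_sqrt (by norm_num)
  have h1 := integral_comp_mul_left_Ioi (fun v => Real.exp (-v ^ 2)) a (inv_pos.2 h2)
  have h3 := (measurePreserving_add_right (volume : Measure ℝ) a).setIntegral_preimage_emb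
    (MeasurableEquiv.addRight a).measurableEmbedding
    (fun x => Real.exp (-((Real.sqrt 2)⁻¹ * x) ^ 2)) (Set.Ioi a)
  have hpre : (fun x : ℝ => x + a) ⁻¹' Set.Ioi a = Set.Ioi 0 := by
    ext x; simp
  rw [hpre, h1] at h3
  have e : ∀ s : ℝ, Real.exp (-(1 / 2) * s ^ 2 - a * s) =
      Real.exp ((a / Real.sqrt 2) ^ 2) * Real.exp (-((Real.sqrt 2)⁻¹ * (s + a)) ^ 2) := by
    intro s
    rw [← Real.exp_add, mul_pow, inv_pow, div_pow, hsq]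
    ring_nf
  simp_rw [e]
  rw [integral_const_mul, h3, expErfc, erfc, inv_inv, smul_eq_mul, mul_comm _ a, ← div_eq_mul_inv]
  have hc : Real.sqrt (Real.pi / 2) * (2 / Real.sqrt Real.pi) = Real.sqrt 2 := by
    rw [Real.sqrt_div Real.pi_pos.le]
    have := Real.sqrt_pos.2 Real.pi_pos
    field_simp
    exact hsq.symm
  rw [← hc]
  ring

/-- The value of `∫_{-s}^0 e^{-a s + (c - a) m} dm`. -/
noncomputable def expDividedDifference (a c s : ℝ) : ℝ :=
  if a = c then s * Real.exp (-a * s) else (Real.exp (-a * s) - Real.exp (-c * s)) / (c - a)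

theorem integral_Ioo_exp (a c : ℝ) {s : ℝ} (hs : 0 < s) :
    ∫ m in Set.Ioo (-s) 0, Real.exp (-a * s + (c - a) * m) = expDividedDifference a c s := by
  rw [← integral_Ioc_eq_integral_Ioo, ← intervalIntegral.integral_of_le (by linarith),
    expDividedDifference]
  split_ifs with h
  · subst h
    simp
  · have hca : c - a ≠ 0 := sub_ne_zero.2 (Ne.symm h)
    have hd : ∀ m ∈ Set.uIcc (-s) 0,
        HasDerivAt (fun m => Real.exp (-a * s + (c - a) * m) / (c - a))
          (Real.exp (-a * s + (c - a) * m)) m := by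
      intro m _
      have := ((((hasDerivAt_id m).const_mul (c - a)).const_add (-a * s)).exp).div_const (c - a)
      refine this.congr_deriv ?_
      simp only [id]
      field_simp
    rw [intervalIntegral.integral_eq_sub_of_hasDerivAt hd
      ((by fun_prop : Continuous fun m : ℝ =>
        Real.exp (-a * s + (c - a) * m)).intervalIntegrable _ _), ← sub_div]
    ring_nf

theorem sqrt_two_div_pi_mul (x : ℝ) :
    Real.sqrt (2 / Real.pi) * (Real.sqrt (Real.pi / 2) * x) = x := by
  rw [← mul_assoc, ← Real.sqrt_mul (by positivity), div_mul_div_comm, mul_comm 2,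
    div_self (by positivity), Real.sqrt_one, one_mul]

/-- For `a ≠ c` this is a difference of two first moments, in which the constants `1` cancel. For `a
= c` it is a second moment, which explains the separate form of `calH` on the diagonal. -/
theorem integral_expDividedDifference (a c : ℝ) :
    IntegrableOn (fun s => Real.sqrt (2 / Real.pi) * (s * Real.exp (-(1 / 2) * s ^ 2)) *
      expDividedDifference a c s) (Set.Ioi 0) ∧
    ∫ s in Set.Ioi (0 : ℝ), Real.sqrt (2 / Real.pi) * (s * Real.exp (-(1 / 2) * s ^ 2)) *
      expDividedDifference a c s = calH a c := by
  have hexp : ∀ b s : ℝ, Real.exp (-(1 / 2) * s ^ 2) * Real.exp (-b * s) =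
      Real.exp (-(1 / 2) * s ^ 2 - b * s) := by
    intro b s
    rw [← Real.exp_add]
    ring_nf
  by_cases h : a = c
  · subst h
    have e : (fun s => Real.sqrt (2 / Real.pi) * (s * Real.exp (-(1 / 2) * s ^ 2)) *
        expDividedDifference a a s) =
        fun s => Real.sqrt (2 / Real.pi) * (s ^ 2 * Real.exp (-(1 / 2) * s ^ 2 - a * s)) := by
      funext s
      rw [expDividedDifference, if_pos rfl, ← hexp]
      ring
    rw [e]
    refine ⟨((integrable_sq_mul_exp_quadratic a).const_mul _).integrableOn, ?_⟩
    rw [integral_const_mul, integral_sq_mul_exp_quadratic, integral_exp_quadratic, calH,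
      if_pos rfl, mul_sub, mul_left_comm, sqrt_two_div_pi_mul]
  · have hca : c - a ≠ 0 := sub_ne_zero.2 (Ne.symm h)
    have hac : a - c ≠ 0 := sub_ne_zero.2 h
    have e : (fun s => Real.sqrt (2 / Real.pi) * (s * Real.exp (-(1 / 2) * s ^ 2)) *
        expDividedDifference a c s) =
        fun s => Real.sqrt (2 / Real.pi) / (c - a) *
          (s * Real.exp (-(1 / 2) * s ^ 2 - a * s) - s * Real.exp (-(1 / 2) * s ^ 2 - c * s)) := by
      funext s
      rw [expDividedDifference, if_neg h, ← hexp, ← hexp]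
      ring
    have ia := integrable_id_mul_exp_quadratic a
    have ic := integrable_id_mul_exp_quadratic c
    rw [e]
    refine ⟨((ia.sub ic).const_mul _).integrableOn, ?_⟩
    rw [integral_const_mul, integral_sub ia.integrableOn ic.integrableOn,
      integral_id_mul_exp_quadratic, integral_id_mul_exp_quadratic, integral_exp_quadratic,
      integral_exp_quadratic, calH, if_neg h]
    have ha := sqrt_two_div_pi_mul (a * expErfc (a / Real.sqrt 2))
    have hc := sqrt_two_div_pi_mul (c * expErfc (c / Real.sqrt 2))
    rw [← ha, ← hc]
    field_simp
    ring

theorem expDividedDifference_nonneg (a c : ℝ) {s : ℝ} (hs : 0 < s) :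
    0 ≤ expDividedDifference a c s := by
  rw [← integral_Ioo_exp a c hs]
  exact integral_nonneg fun _ => (Real.exp_pos _).le

/-- In the coordinate `s = y - 2 * m` the joint density of minimum and endpoint no longer depends on
`m`. -/
theorem kernelSlope_one (m s : ℝ) :
    kernelSlope m 1 0 (s + 2 * m) =
      Real.sqrt (2 / Real.pi) * (s * Real.exp (-(1 / 2) * s ^ 2)) := by
  have h : 1 / Real.sqrt (2 * Real.pi * 1) * 2 = Real.sqrt (2 / Real.pi) := by
    rw [mul_one, Real.sqrt_mul zero_le_two, Real.sqrt_div zero_le_two]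
    have h2 : (0 : ℝ) < Real.sqrt 2 := by positivity
    have := Real.sqrt_pos.2 Real.pi_pos
    field_simp
    exact (Real.sq_sqrt zero_le_two).symm
  rw [kernelSlope, ← h]
  ring_nf

theorem minJointDensity_one (m y : ℝ) :
    minJointDensity (d := 1) ![0, 1] (m, fun _ => y) =
      open Classical in if m < 0 ∧ m < y then ENNReal.ofReal (kernelSlope m 1 0 y) else 0 := by
  classical
  have h1 : m < minValue (Fin.cons 0 (fun _ : Fin 1 => y)) ↔ m < 0 ∧ m < y := by
    rw [lt_minValue_iff, Fin.forall_fin_two]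
    rfl
  have h2 : productSlope ![0, 1] (Fin.cons 0 (fun _ : Fin 1 => y)) m = kernelSlope m 1 0 y := by
    simp [productSlope]
  simp only [minJointDensity, h1, h2]

variable {Ω : Type*} [MeasurableSpace Ω] {P : Measure Ω} {X : ℝ≥0 → Ω → ℝ}

/-- The joint law for the single time `1` turns the expectation into a double integral over minimum
and endpoint; the inner integral over the minimum is elementary after a shift and an exchange of
order. -/
theorem IsRegularBrownian.lintegral_weight (hX : IsRegularBrownian X P) (a c : ℝ) :
    ∫⁻ ω, ENNReal.ofReal (Real.exp ((a + c) * pathMin 1 (X · ω) - a * X 1 ω)) ∂P =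
      ENNReal.ofReal (calH a c) := by
  classical
  have hlaw := hX.map_pathMin_prod (d := 1) one_ne_zero (t := ![0, 1])
    (by intro i j; fin_cases i <;> fin_cases j <;> simp) rfl
  let h : ℝ × (Fin 1 → ℝ) → ENNReal := fun p =>
    ENNReal.ofReal (Real.exp ((a + c) * p.1 - a * p.2 0))
  have hh : Measurable h := by fun_prop
  have e1 : ∫⁻ ω, ENNReal.ofReal (Real.exp ((a + c) * pathMin 1 (X · ω) - a * X 1 ω)) ∂P =
      ∫⁻ m, ∫⁻ y, minJointDensity (d := 1) ![0, 1] (m, fun _ => y) *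
        ENNReal.ofReal (Real.exp ((a + c) * m - a * y)) := by
    have h1 := congrArg (fun μ => ∫⁻ p, h p ∂μ) hlaw
    beta_reduce at h1
    have ht : (fun k : Fin 2 => ((![0, 1] : Fin 2 → ℝ≥0) k : ℝ)) = ![0, 1] := by
      funext k; fin_cases k <;> rfl
    rw [lintegral_map hh ((hX.measurable_pathMin _).prodMk
      (measurable_pi_lambda _ fun _ => hX.meas _)),
      lintegral_withDensity_eq_lintegral_mul _ (measurable_minJointDensity _) hh,
      lintegral_prod _ ((measurable_minJointDensity _).mul hh).aemeasurable, ht] at h1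
    refine h1.trans (lintegral_congr fun m => ?_)
    have hm : Measurable fun z : Fin 1 → ℝ => (minJointDensity (d := 1) ![0, 1] * h) (m, z) :=
      ((measurable_minJointDensity _).mul hh).comp measurable_prodMk_left
    exact ((volume_preserving_funUnique (Fin 1) ℝ).symm.lintegral_comp hm).symm
  have e2 : ∀ m, ∫⁻ y, minJointDensity (d := 1) ![0, 1] (m, fun _ => y) *
        ENNReal.ofReal (Real.exp ((a + c) * m - a * y)) =
      ∫⁻ s, if -s < m ∧ m < 0 then ENNReal.ofReal (Real.sqrt (2 / Real.pi) *
        (s * Real.exp (-(1 / 2) * s ^ 2)) * Real.exp (-a * s + (c - a) * m)) else 0 := by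
    intro m
    -- Substitute `y = s + 2 * m`: the exponent `(a + c) * m - a * y` becomes `-a * s + (c - a) *
    -- m`, and the region becomes `-s < m < 0`.
    rw [← lintegral_add_right_eq_self _ (2 * m)]
    refine lintegral_congr fun s => ?_
    rw [minJointDensity_one, kernelSlope_one]
    have hiff : (m < 0 ∧ m < s + 2 * m) ↔ (-s < m ∧ m < 0) :=
      ⟨fun h => ⟨by linarith [h.2], h.1⟩, fun h => ⟨h.2, by linarith [h.1]⟩⟩
    simp only [hiff]
    split_ifs with hm
    · rw [← ENNReal.ofReal_mul' (Real.exp_pos _).le]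
      congr 3
      ring
    · rw [zero_mul]
  rw [e1, lintegral_congr e2, lintegral_lintegral_swap]
  swap
  · refine Measurable.aemeasurable (Measurable.ite (MeasurableSet.inter
      (s₁ := {p : ℝ × ℝ | -p.2 < p.1}) (s₂ := {p : ℝ × ℝ | p.1 < 0}) ?_ ?_) (by fun_prop)
      measurable_const)
    · exact measurableSet_lt (by fun_prop) (by fun_prop)
    · exact measurableSet_lt (by fun_prop) (by fun_prop)
  obtain ⟨hint, hval⟩ := integral_expDividedDifference a c
  rw [← hval, ofReal_integral_eq_lintegral_ofReal hint, ← lintegral_indicator measurableSet_Ioi]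
  swap
  · filter_upwards [ae_restrict_mem measurableSet_Ioi] with s hs
    have hs' : 0 < s := hs
    have := expDividedDifference_nonneg a c hs'
    simp only [Pi.zero_apply]
    positivity
  refine lintegral_congr fun s => ?_
  rw [Set.indicator_apply]
  split_ifs with hs
  · have hs' : 0 < s := hs
    rw [← integral_Ioo_exp a c hs', ← integral_const_mul, ofReal_integral_eq_lintegral_ofReal,
      ← lintegral_indicator measurableSet_Ioo]
    · simp only [Set.indicator_apply, Set.mem_Ioo]
    · exact ((by fun_prop : Continuous fun m : ℝ => Real.sqrt (2 / Real.pi) *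
        (s * Real.exp (-(1 / 2) * s ^ 2)) * Real.exp (-a * s + (c - a) * m)).integrableOn_Icc
          (a := -s) (b := 0)).mono_set Set.Ioo_subset_Icc_self
    · refine Eventually.of_forall fun m => ?_
      simp only [Pi.zero_apply]
      positivity
  · have hs' : s ≤ 0 := not_lt.1 hs
    rw [lintegral_congr (g := fun _ => 0) fun m => if_neg fun h => by linarith [h.1, h.2]]
    simp

/-- Positivity is read off from the probabilistic meaning: `calH` is the expectation of an
exponential. -/
theorem IsRegularBrownian.calH_pos (hX : IsRegularBrownian X P) (a c : ℝ) : 0 < calH a c := by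
  have := hX.isProbabilityMeasure
  by_contra hneg
  have h := hX.lintegral_weight a c
  rw [ENNReal.ofReal_of_nonpos (not_lt.1 hneg), lintegral_eq_zero_iff] at h
  · obtain ⟨ω, hω⟩ := h.exists
    simp only [Pi.zero_apply, ENNReal.ofReal_eq_zero] at hω
    exact absurd (Real.exp_pos _) (not_lt.2 hω)
  · have := hX.measurable_pathMin 1
    have := hX.meas 1
    fun_prop

end Normalisation

/-! ### Measurability and positivity of the joint density -/

section Density

variable {d : ℕ}

/-- The joint density, with the derivative written out. -/
theorem jointDensity_eq (a c : ℝ) (t : Fin (d + 1) → ℝ) (z : Fin d → ℝ) :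
    jointDensity a c t z = 1 / calH a c * ∫ b in Set.Iio (minValue (Fin.cons 0 z)),
      Real.exp ((a + c) * b - a * (Fin.cons 0 z : Fin (d + 1) → ℝ) (Fin.last d)) *
        productSlope t (Fin.cons 0 z) b := by
  rw [jointDensity, integral_Iic_eq_integral_Iio]
  congr 1
  exact setIntegral_congr_fun measurableSet_Iio fun b hb => densityIntegrand_eq a c t _ hb

theorem measurable_last_cons_zero :
    Measurable fun z : Fin d → ℝ => (Fin.cons 0 z : Fin (d + 1) → ℝ) (Fin.last d) :=
  (measurable_pi_apply _).comp (measurable_cons_zero d)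

theorem measurable_jointDensity (a c : ℝ) (t : Fin (d + 1) → ℝ) :
    Measurable (jointDensity a c t : (Fin d → ℝ) → ℝ) := by
  classical
  have h : (jointDensity a c t : (Fin d → ℝ) → ℝ) = fun z => 1 / calH a c * ∫ b : ℝ,
      if b < minValue (Fin.cons 0 z) then
        Real.exp ((a + c) * b - a * (Fin.cons 0 z : Fin (d + 1) → ℝ) (Fin.last d)) *
          productSlope t (Fin.cons 0 z) b else 0 := by
    funext z
    rw [jointDensity_eq, ← integral_indicator measurableSet_Iio]
    simp only [Set.indicator_apply, Set.mem_Iio]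
  rw [h]
  refine Measurable.const_mul (StronglyMeasurable.measurable ?_) _
  have hm : Measurable fun p : ℝ × (Fin d → ℝ) => if p.1 < minValue (Fin.cons 0 p.2) then
      Real.exp ((a + c) * p.1 - a * (Fin.cons 0 p.2 : Fin (d + 1) → ℝ) (Fin.last d)) *
        productSlope t (Fin.cons 0 p.2) p.1 else 0 := by
    refine Measurable.ite measurableSet_lt_minValue_cons ?_ measurable_const
    refine Measurable.mul (Real.measurable_exp.comp ?_) (measurable_productSlope_cons_zero t)
    exact (measurable_fst.const_mul _).sub
      ((measurable_last_cons_zero.comp measurable_snd).const_mul _)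
  exact hm.stronglyMeasurable.integral_prod_left'

theorem jointDensity_nonneg {a c : ℝ} (hH : 0 < calH a c) {t : Fin (d + 1) → ℝ} (ht : Monotone t)
    (z : Fin d → ℝ) : 0 ≤ jointDensity a c t z := by
  rw [jointDensity_eq]
  exact mul_nonneg (by positivity) (setIntegral_nonneg measurableSet_Iio fun b hb =>
    mul_nonneg (Real.exp_pos _).le (productSlope_nonneg ht (le_of_lt hb)))

/-- Integrates the minimum out of the weighted joint law, which produces the integral over `b` in
the density. -/
theorem lintegral_minJointDensity_mul {a c : ℝ} (hH : 0 < calH a c) {t : Fin (d + 1) → ℝ}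
    (ht : StrictMono t) (z : Fin d → ℝ) :
    ∫⁻ m, minJointDensity t (m, z) * ENNReal.ofReal
        (Real.exp ((a + c) * m - a * (Fin.cons 0 z : Fin (d + 1) → ℝ) (Fin.last d)) / calH a c) =
      ENNReal.ofReal (jointDensity a c t z) := by
  classical
  rw [jointDensity_eq, ← integral_const_mul, ofReal_integral_eq_lintegral_ofReal,
    ← lintegral_indicator measurableSet_Iio]
  · refine lintegral_congr fun m => ?_
    simp only [Set.indicator_apply, Set.mem_Iio, minJointDensity]
    split_ifs with hm
    · rw [← ENNReal.ofReal_mul (productSlope_nonneg ht.monotone hm.le)]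
      congr 1
      ring
    · rw [zero_mul]
  · simp only [sub_eq_add_neg]
    exact ((integrable_exp_mul_productSlope ht _ _ _).const_mul _).integrableOn
  · filter_upwards [ae_restrict_mem measurableSet_Iio] with b hb
    exact mul_nonneg (by positivity) (mul_nonneg (Real.exp_pos _).le
      (productSlope_nonneg ht.monotone (le_of_lt hb)))

end Density

/-! ### Transfer to path space -/

section Paths

variable {Ω : Type*} [MeasurableSpace Ω] {P : Measure Ω} {X : ℝ≥0 → Ω → ℝ}

theorem IsRegularBrownian.pathOn_apply (hX : IsRegularBrownian X P) (ω : Ω) (s : I) :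
    pathOn X ω s = X ⟨s, s.2.1⟩ ω := by
  have hc : Continuous (fun s : I => X ⟨s, s.2.1⟩ ω) := (hX.continuous_path ω).comp (by fun_prop)
  simp only [pathOn, dif_pos hc]
  rfl

theorem IsRegularBrownian.measurable_pathOn (hX : IsRegularBrownian X P) :
    Measurable (pathOn X) :=
  measurable_path_of_eval fun s => by
    simp only [hX.pathOn_apply]
    exact hX.meas _

theorem IsRegularBrownian.pathWeight_pathOn (hX : IsRegularBrownian X P) (a c : ℝ) (ω : Ω) :
    pathWeight a c (pathOn X ω) = Real.exp ((a + c) * pathMin 1 (X · ω) - a * X 1 ω) := by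
  have h1 : (⟨((1 : I) : ℝ), (1 : I).2.1⟩ : ℝ≥0) = 1 := rfl
  have h2 : ∀ s : I, X (1 * ⟨s, s.2.1⟩) ω = X ⟨s, s.2.1⟩ ω := fun s =>
    congrArg (X · ω) (one_mul (⟨s, s.2.1⟩ : ℝ≥0))
  simp only [pathWeight, hX.pathOn_apply, pathMin, h1, h2]
  rfl

theorem pathWeight_pos (a c : ℝ) (ω : C(I, ℝ)) : 0 < pathWeight a c ω :=
  Real.exp_pos _

theorem measurable_pathWeight (a c : ℝ) : Measurable (pathWeight a c) := by
  have he : ∀ s : I, Measurable fun ω : C(I, ℝ) => ω s := fun s =>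
    (by fun_prop : Continuous fun ω : C(I, ℝ) => ω s).measurable
  unfold pathWeight
  simp_rw [iInf_eq_iInf_denseSeq (ContinuousMap.continuous _)]
  have h1 : Measurable fun ω : C(I, ℝ) => ⨅ n, ω (TopologicalSpace.denseSeq I n) :=
    Measurable.iInf fun n => he _
  exact Real.measurable_exp.comp ((h1.const_mul _).sub ((he 1).const_mul _))

theorem IsRegularBrownian.integral_pathWeight (hX : IsRegularBrownian X P) (a c : ℝ) :
    ∫ ω, pathWeight a c ω ∂(pathLaw P X) = calH a c := by
  rw [integral_eq_lintegral_of_nonneg_ae (Eventually.of_forall fun ω => (pathWeight_pos a c ω).le)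
    (measurable_pathWeight a c).aestronglyMeasurable, pathLaw,
    lintegral_map (measurable_pathWeight a c).ennreal_ofReal hX.measurable_pathOn]
  simp_rw [hX.pathWeight_pathOn]
  rw [hX.lintegral_weight, ENNReal.toReal_ofReal (hX.calH_pos a c).le]

theorem pathLaw_congr {B : ℝ≥0 → Ω → ℝ} (h : ∀ᵐ ω ∂P, ∀ t, B t ω = X t ω) :
    pathLaw P B = pathLaw P X := by
  refine Measure.map_congr ?_
  filter_upwards [h] with ω hω
  unfold pathOn
  have e' : (fun s : I => B ⟨s, s.2.1⟩ ω) = fun s : I => X ⟨s, s.2.1⟩ ω := funext fun s => hω _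
  rw [e']

/-- Both the weight and the test function factor through the minimum and the values at the given
times, so the change of measure can be carried out under the law of `map_pathMin_prod`. -/
theorem IsRegularBrownian.map_etaLaw (hX : IsRegularBrownian X P) (a c : ℝ) {d : ℕ}
    {t : Fin (d + 1) → I} (ht : StrictMono t) (ht0 : t 0 = 0) (ht1 : t (Fin.last d) = 1) :
    (etaLaw a c (pathLaw P X)).map (fun ω (k : Fin d) => ω (t k.succ)) =
      volume.withDensity fun z : Fin d → ℝ =>
        ENNReal.ofReal (jointDensity a c (fun k => (t k : ℝ)) z) := by
  have hd : d ≠ 0 := by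
    rintro rfl
    have : (0 : I) = 1 := ht0.symm.trans ht1
    exact zero_ne_one this
  have hH := hX.calH_pos a c
  have hpm : Measurable (pathWeight a c) := measurable_pathWeight a c
  have hE : Measurable fun (ω : C(I, ℝ)) (k : Fin d) => ω (t k.succ) :=
    measurable_pi_lambda _ fun k =>
      (by fun_prop : Continuous fun ω : C(I, ℝ) => ω (t k.succ)).measurable
  let τ : Fin (d + 1) → ℝ≥0 := fun k => ⟨t k, (t k).2.1⟩
  have hτ : StrictMono τ := fun i j hij => ht hij
  have hτ0 : τ 0 = 0 := by
    apply NNReal.eq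
    change (t 0 : ℝ) = 0
    rw [ht0]; rfl
  have hτ1 : τ (Fin.last d) = 1 := by
    apply NNReal.eq
    change (t (Fin.last d) : ℝ) = 1
    rw [ht1]; rfl
  have htR : StrictMono fun k => (t k : ℝ) := fun i j hij => ht hij
  have hlaw := hX.map_pathMin_prod hd hτ hτ0
  rw [hτ1] at hlaw
  -- Since `d ≠ 0`, the last entry is the value at `t_d = 1` and not the prepended `0`; this matches
  -- the `z_d` in the density with `ω 1` in the weight.
  have hlast : ∀ ω, (Fin.cons 0 (fun k : Fin d => X (τ k.succ) ω) : Fin (d + 1) → ℝ)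
      (Fin.last d) = X 1 ω := by
    intro ω
    obtain ⟨n, rfl⟩ := Nat.exists_eq_succ_of_ne_zero hd
    rw [← hτ1]
    exact Fin.cons_succ (α := fun _ => ℝ) 0 (fun k => X (τ k.succ) ω) (Fin.last n)
  refine Measure.ext_of_lintegral _ fun f hf => ?_
  let h : ℝ × (Fin d → ℝ) → ENNReal := fun p => ENNReal.ofReal
    (Real.exp ((a + c) * p.1 - a * (Fin.cons 0 p.2 : Fin (d + 1) → ℝ) (Fin.last d)) / calH a c) *
      f p.2
  have hw : Measurable fun p : ℝ × (Fin d → ℝ) => ENNReal.ofReal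
      (Real.exp ((a + c) * p.1 - a * (Fin.cons 0 p.2 : Fin (d + 1) → ℝ) (Fin.last d)) /
        calH a c) :=
    ((Real.measurable_exp.comp ((measurable_fst.const_mul _).sub
      ((measurable_last_cons_zero.comp measurable_snd).const_mul _))).div_const _).ennreal_ofReal
  have hh : Measurable h := hw.mul (hf.comp measurable_snd)
  have hD : Measurable fun ω : C(I, ℝ) => ENNReal.ofReal (pathWeight a c ω / calH a c) :=
    (hpm.div_const _).ennreal_ofReal
  have hfE : Measurable fun ω : C(I, ℝ) => f fun k => ω (t k.succ) := hf.comp hE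
  have h1 := congrArg (fun μ => ∫⁻ p, h p ∂μ) hlaw
  beta_reduce at h1
  rw [lintegral_map hh ((hX.measurable_pathMin _).prodMk
      (measurable_pi_lambda _ fun _ => hX.meas _)),
    lintegral_withDensity_eq_lintegral_mul _ (measurable_minJointDensity _) hh,
    lintegral_prod_symm' _ ((measurable_minJointDensity _).mul hh)] at h1
  rw [lintegral_map hf hE, etaLaw, hX.integral_pathWeight,
    lintegral_withDensity_eq_lintegral_mul (g := fun ω : C(I, ℝ) => f fun k => ω (t k.succ)) _ hD
      hfE, pathLaw,
    lintegral_map (hD.mul hfE) hX.measurable_pathOn,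
    lintegral_withDensity_eq_lintegral_mul _ (measurable_jointDensity a c _).ennreal_ofReal hf]
  have h2 : ∀ ω, ((fun ω : C(I, ℝ) => ENNReal.ofReal (pathWeight a c ω / calH a c)) *
      fun ω : C(I, ℝ) => f fun k => ω (t k.succ)) (pathOn X ω) =
      h (pathMin 1 (X · ω), fun k => X (τ k.succ) ω) := by
    intro ω
    simp only [Pi.mul_apply, hX.pathWeight_pathOn, hX.pathOn_apply, h, hlast]
    rfl
  rw [lintegral_congr h2, h1]
  refine lintegral_congr fun z => ?_
  simp only [Pi.mul_apply, h, ← mul_assoc]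
  rw [lintegral_mul_const]
  · rw [← lintegral_minJointDensity_mul hH htR z]
    rfl
  · exact ((measurable_minJointDensity _).mul hw).comp measurable_prodMk_right

end Paths
end OpenKPZ

theorem proposition3p2 {Ω Ω' : Type*} [MeasurableSpace Ω] [MeasurableSpace Ω']
    (P : Measure Ω) (P' : Measure Ω')
    -- a standard Brownian motion on `(Ω, P)`
    (B : ℝ≥0 → Ω → ℝ) (hB : IsBrownianReal B P)
    -- real parameters and a process `η` on `(Ω', P')` with continuous paths and the law of
    -- `η^{(a,c)}`
    (a c : ℝ) (η : Ω' → C(I, ℝ)) (hη : HasLaw η (OpenKPZ.etaLaw a c (OpenKPZ.pathLaw P B)) P')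
    -- times `0 = t_0 < t_1 < ⋯ < t_d = 1`
    (d : ℕ) (t : Fin (d + 1) → I) (ht : StrictMono t) (ht0 : t 0 = 0) (ht1 : t (Fin.last d) = 1) :
    -- the expression defining the density is meaningful at every point
    (∀ z : Fin d → ℝ,
      (∀ b < OpenKPZ.minValue (Fin.cons 0 z),
        DifferentiableAt ℝ (OpenKPZ.killedProduct (fun k => (t k : ℝ)) (Fin.cons 0 z)) b) ∧
      IntegrableOn (OpenKPZ.densityIntegrand a c (fun k => (t k : ℝ)) (Fin.cons 0 z))
        (Set.Iic (OpenKPZ.minValue (Fin.cons 0 z)))) ∧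
    -- it is a measurable nonnegative function of `z`
    Measurable (OpenKPZ.jointDensity a c (fun k => (t k : ℝ)) : (Fin d → ℝ) → ℝ) ∧
    (∀ z : Fin d → ℝ, 0 ≤ OpenKPZ.jointDensity a c (fun k => (t k : ℝ)) z) ∧
    -- it is the density of `(η_{t_1}, …, η_{t_d})` with respect to Lebesgue measure on `ℝ^d`
    HasLaw (fun x (k : Fin d) => η x (t k.succ))
      (volume.withDensity fun z : Fin d → ℝ =>
        ENNReal.ofReal (OpenKPZ.jointDensity a c (fun k => (t k : ℝ)) z)) P' := by

  -- The law of `η` depends on the Brownian motion only through its path law, so `B` may be replaced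
  -- by a regular version.
  obtain ⟨X, hX, hBX⟩ := OpenKPZ.exists_isRegularBrownian hB
  rw [OpenKPZ.pathLaw_congr hBX] at hη
  have htR : StrictMono fun k => (t k : ℝ) := fun i j hij => ht hij
  have hE : Measurable fun (ω : C(I, ℝ)) (k : Fin d) => ω (t k.succ) :=
    measurable_pi_lambda _ fun k =>
      (by fun_prop : Continuous fun ω : C(I, ℝ) => ω (t k.succ)).measurable
  refine ⟨fun z => ⟨fun b hb => (OpenKPZ.hasDerivAt_killedProduct _ _ hb).differentiableAt,
    OpenKPZ.integrableOn_densityIntegrand a c htR _⟩, OpenKPZ.measurable_jointDensity a c _,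
    fun z => OpenKPZ.jointDensity_nonneg (hX.calH_pos a c) htR.monotone z,
    hE.comp_aemeasurable hη.aemeasurable, ?_⟩
  rw [← hX.map_etaLaw a c ht ht0 ht1, ← hη.map_eq,
    AEMeasurable.map_map_of_aemeasurable hE.aemeasurable hη.aemeasurable]
  rfl
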